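/- Let $L$ be an oriented singular link with exactly $r$ double points, and let $D$ be any (planar) diagram of $L$. For a set $A$ of double points of $D$ let $D_A$ be the ordinary link diagram obtained by resolving the double points in $A$ to positive crossings and the other double points to negative crossings. For an ordinary link diagram $E$ with $n_\pm$ positive/negative crossings, let $C^{*,*}(E;\mathbb F_2)$ be the Khovanov complex with coefficients in $\mathbb F_2$: it has a basis of pairs $(s,\rho)$, where $s$ is a set of crossings, $E_s$ is the $1$-manifold obtained by $1$-smoothing the crossings in $s$ and $0$-smoothing the others (the $0$-smoothing of a positive and the $1$-smoothing of a negative crossing are the orientation-preserving ones), and $\rho:\pi_0(E_s)\to\{1,x\}$; the bidegree of $(s,\rho)$ is $(|s|-n_-,\ \#\rho^{-1}(1)-\#\rho^{-1}(x)+|s|+n_+-2n_-)$; the differential is the sum of the saddle maps from $0$- to $1$-smoothings given by the Frobenius algebra $\mathbb F_2[x]/(x^2)$, $\Delta(1)=x\otimes 1+1\otimes x$, $\Delta(x)=x\otimes x$. For a double point $b\notin A$, the genus-$1$ map $\widehat\Phi_b:C(D_A;\mathbb F_2)\to C(D_{A\cup\{b\}};\mathbb F_2)$ is zero on the $0$-smoothing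 of the negative crossing at $b$ and maps its $1$-smoothing to the $0$-smoothing of the positive crossing at $b$ (both are the orientation-preserving smoothing) by the composite of the saddle map to the other smoothing of $b$ and the saddle map back. Let $C(D;\mathbb F_2)=\bigoplus_A C(D_A;\mathbb F_2)[-(r-|A|)]$, where $W[-k]^{i}=W^{i+k}$, be the multiple mapping cone of the cube $(\{C(D_A;\mathbb F_2)\}_A,\{\widehat\Phi_b\}_b)$, with differential the sum of the differentials of the $C(D_A;\mathbb F_2)$ and of all the $\widehat\Phi_b$. Let $\widetilde V$ be the unnormalized Jones polynomial, computed from a link diagram $E$ by $$\widetilde V(E)=(-1)^{n_-}q^{n_+-2n_-}\sum_{s}(-q)^{|s|}(q+q^{-1})^{\#\pi_0(E_s)}\in\mathbb Z[q,q^{-1}],$$ and let its derivatives be defined by $\widetilde V^{(0)}=\widetilde V$ and by the Vassiliev skein relation $\widetilde V^{(k+1)}(D)=\widetilde V^{(k)}(D_+)-\widetilde V^{(k)}(D_-)$ for every singular link diagram $D$ with $k+1$ double points and every double point $b$ of $D$, where $D_\pm$ is $D$ with $b$ resolved to a $\pm$ crossing. Then $C(D;\mathbb F_2)$ is a cochain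 complex in each quantum degree $j$, the value $\widetilde V^{(r)}(D)$ does not depend on the order in which the double points are resolved, and, with $\mathit{Kh}^{i,j}(D;\mathbb F_2):=H^i(C^{*,j}(D;\mathbb F_2))$, $$\sum_{i,j}(-1)^iq^j\dim_{\mathbb F_2}\mathit{Kh}^{i,j}(D;\mathbb F_2)=\widetilde V^{(r)}(D).$$ (The Khovanov homology $\mathit{Kh}(L;\mathbb F_2)$ and the derivative $\widetilde V^{(r)}(L)$ of the singular link $L$ are, by definition, computed from an arbitrary diagram $D$ of $L$, so this reads $[\mathit{Kh}(L;\mathbb F_2)]_q=\widetilde V^{(r)}(L)$.) -/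

import Mathlib

open scoped LaurentPolynomial

/-! ## Oriented singular link diagrams -/

/-- Left or right, seen by an observer who looks at a vertex of a diagram in such a way that both
strands run upwards. -/
inductive Side
  | left
  | right
  deriving DecidableEq

instance : Fintype Side := ⟨{.left, .right}, by rintro (_ | _) <;> simp⟩

/-- The sign of a crossing. -/
inductive CrossingSign
  | pos
  | neg
  deriving DecidableEq

/-- The type of a vertex of a singular link diagram: an ordinary (positive or negative) crossing,
or a double point. -/
inductive VertexKind
  | crossing (ε : CrossingSign)
  | double
  deriving DecidableEq

/-- The four ends of edges at a vertex: with both strands running upwards, `inc left`, `inc right`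
are the incoming ends at the lower left and the lower right, and `out left`, `out right` are the
outgoing ends at the upper left and the upper right. The two strands through the vertex are
`inc left → out right` and `inc right → out left`. -/
inductive EdgeEnd
  | inc (b : Side)
  | out (b : Side)
  deriving DecidableEq

/-- The counterclockwise cyclic order of the four ends around a vertex. -/
def EdgeEnd.ccw : EdgeEnd → EdgeEnd
  | .out .right => .out .left
  | .out .left => .inc .left
  | .inc .left => .inc .right
  | .inc .right => .out .right

/-- The other end of an edge: `next (v, b) = (w, c)` says that the edge which leaves `v` at the
upper side `b` arrives at `w` from the lower side `c`. -/
def otherEnd {V : Type*} (next : V × Side ≃ V × Side) : V × EdgeEnd → V × EdgeEnd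
  | (v, .out b) => ((next (v, b)).1, .inc (next (v, b)).2)
  | (v, .inc b) => ((next.symm (v, b)).1, .out (next.symm (v, b)).2)

/-- The faces of the ribbon surface determined by `next`: the orbits on edge ends of
"go to the other end of the edge, then turn to the next end at that vertex". -/
def ShadowFaces {V : Type*} (next : V × Side ≃ V × Side) : Type _ :=
  Quot fun d d' : V × EdgeEnd =>
    d' = ((otherEnd next d).1, (otherEnd next d).2.ccw)

/-- The connected components of the underlying four-valent graph. -/
def ShadowComponents {V : Type*} (next : V × Side ≃ V × Side) : Type _ :=
  Quot fun v w : V => ∃ b : Side, w = (next (v, b)).1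

/-- The underlying oriented immersed curves in the plane (sphere) of a link diagram: an oriented
four-valent plane graph with vertex set `V`, given by its rotation system, and a number of simple
closed curves without vertices. The graph has `|V|` vertices and `2|V|` edges, so Euler's formula
`|V| - 2|V| + #faces = 2 #components` says exactly that each component has genus `0`. -/
structure Shadow (V : Type*) [Fintype V] where
  next : V × Side ≃ V × Side
  freeCircles : ℕ
  planar : Nat.card (ShadowFaces next) = Fintype.card V + 2 * Nat.card (ShadowComponents next)

/-- A diagram of an oriented link. -/
structure LinkDiagram (V : Type*) [Fintype V] where
  shadow : Shadow V
  sign : V → CrossingSign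

/-- A diagram of an oriented singular link. -/
structure SingularLinkDiagram (V : Type*) [Fintype V] where
  shadow : Shadow V
  kind : V → VertexKind

/-- A link diagram is a singular link diagram without double points. -/
def LinkDiagram.toSingular {V : Type*} [Fintype V] (L : LinkDiagram V) : SingularLinkDiagram V where
  shadow := L.shadow
  kind v := .crossing (L.sign v)

namespace SingularLinkDiagram

variable {V : Type*} [Fintype V] [DecidableEq V]

/-- The set of double points. -/
def doublePoints (D : SingularLinkDiagram V) : Finset V :=
  Finset.univ.filter fun v => D.kind v = .double

/-- The diagram in which the vertex `b` is replaced by a crossing of sign `ε`. -/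
def resolve (D : SingularLinkDiagram V) (b : V) (ε : CrossingSign) : SingularLinkDiagram V where
  shadow := D.shadow
  kind := Function.update D.kind b (.crossing ε)

/-- The signs in the link diagram `D_A`, obtained from `D` by resolving the double points in `A`
to positive crossings and the double points outside of `A` to negative crossings. -/
def signOf (D : SingularLinkDiagram V) (A : Finset V) (v : V) : CrossingSign :=
  match D.kind v with
  | .crossing ε => ε
  | .double => if v ∈ A then .pos else .neg

end SingularLinkDiagram

/-- `HasVassilievDerivative v r D a` says that `v^{(r)}(D) = a`, where the `r`-th derivatives of
`v` are defined inductively by `v^{(0)} = v` and, for each double point `b` of `D`, by the Vassiliev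
skein relation `v^{(r+1)}(D) = v^{(r)}(D_+) - v^{(r)}(D_-)`, where `D_±` is `D` with `b` resolved to
a `±` crossing. -/
inductive HasVassilievDerivative {V : Type*} [Fintype V] [DecidableEq V] {M : Type*} [AddCommGroup M]
    (v : LinkDiagram V → M) : ℕ → SingularLinkDiagram V → M → Prop
  | zero (L : LinkDiagram V) : HasVassilievDerivative v 0 L.toSingular (v L)
  | succ (r : ℕ) (D : SingularLinkDiagram V) (b : V) (hb : D.kind b = .double) (x y : M)
      (hx : HasVassilievDerivative v r (D.resolve b .pos) x)
      (hy : HasVassilievDerivative v r (D.resolve b .neg) y) :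
      HasVassilievDerivative v (r + 1) D (x - y)

/-! ## Smoothings and states -/

/-- The two smoothings of a vertex: `vert` joins the lower left to the upper left end and the lower
right to the upper right end (it respects orientations), `horiz` joins the two lower ends and the
two upper ends. -/
inductive Smoothing
  | vert
  | horiz
  deriving DecidableEq

namespace Shadow

variable {V : Type*} [Fintype V]

/-- The edges of a shadow, an edge of the graph being named after its initial end, together with
the closed curves without vertices. -/
abbrev Edge (S : Shadow V) : Type _ := (V × Side) ⊕ Fin S.freeCircles

/-- The edge that leaves `v` at the upper side `b`. -/
def outEdge (S : Shadow V) (v : V) (b : Side) : S.Edge := .inl (v, b)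

/-- The edge that arrives at `v` from the lower side `b`. -/
def inEdge (S : Shadow V) (v : V) (b : Side) : S.Edge := .inl (S.next.symm (v, b))

/-- The edges `e`, `e'` are joined at the vertex `v` if it is smoothed as prescribed. -/
inductive Joined (S : Shadow V) (v : V) : Smoothing → S.Edge → S.Edge → Prop
  | vert (b : Side) : Joined S v .vert (S.inEdge v b) (S.outEdge v b)
  | lower : Joined S v .horiz (S.inEdge v .left) (S.inEdge v .right)
  | upper : Joined S v .horiz (S.outEdge v .left) (S.outEdge v .right)

/-- The set of circles (connected components) of the closed `1`-manifold obtained by smoothing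
every vertex `v` according to `σ v`. -/
def Circles (S : Shadow V) (σ : V → Smoothing) : Type _ :=
  Quot fun e e' : S.Edge => ∃ v, S.Joined v (σ v) e e'

/-- The circle through an edge. -/
def circle (S : Shadow V) (σ : V → Smoothing) (e : S.Edge) : S.Circles σ := Quot.mk _ e

instance (S : Shadow V) (σ : V → Smoothing) : Finite (S.Circles σ) :=
  Finite.of_surjective (S.circle σ) Quot.mk_surjective

end Shadow

/-- The smoothing of a crossing of sign `ε`: its `1`-smoothing if `one`, its `0`-smoothing
otherwise. -/
def CrossingSign.smoothing (ε : CrossingSign) (one : Prop) [Decidable one] : Smoothing :=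
  match ε with
  | .pos => if one then .horiz else .vert
  | .neg => if one then .vert else .horiz

/-- The smoothings of all crossings given by a state `s`: the crossings in `s` are `1`-smoothed,
the others are `0`-smoothed. -/
def stateSmoothing {V : Type*} [DecidableEq V] (ε : V → CrossingSign) (s : Finset V) (v : V) :
    Smoothing :=
  (ε v).smoothing (v ∈ s)

/-- The number of crossings of the sign `e`. -/
def numSign {V : Type*} [Fintype V] (ε : V → CrossingSign) (e : CrossingSign) : ℕ :=
  (Finset.univ.filter fun v => ε v = e).card

/-! ## The unnormalized Jones polynomial -/

/-- The unnormalized Jones polynomial, in the variable `q = T 1`, with value `q + q⁻¹` on the unknot: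
`(-1)^{n_-} q^{n_+ - 2 n_-} ⟨L⟩`, where `⟨L⟩ = ∑_s (-q)^{|s|} (q + q⁻¹)^{#circles of L_s}`
is the Kauffman bracket (`⟨crossing⟩ = ⟨0-smoothing⟩ - q ⟨1-smoothing⟩`, `⟨k circles⟩ = (q + q⁻¹)^k`). -/
noncomputable def LinkDiagram.jones {V : Type*} [Fintype V] [DecidableEq V] (L : LinkDiagram V) :
    ℤ[T;T⁻¹] :=
  (-1) ^ numSign L.sign .neg *
    LaurentPolynomial.T ((numSign L.sign .pos : ℤ) - 2 * (numSign L.sign .neg : ℤ)) *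
    ∑ s : Finset V, (-LaurentPolynomial.T 1) ^ s.card *
      (LaurentPolynomial.T 1 + LaurentPolynomial.T (-1)) ^
        Nat.card (L.shadow.Circles (stateSmoothing L.sign s))

/-! ## The Khovanov complex of a singular link diagram over `𝔽₂` -/

/-- The basis `1, x` of the Frobenius algebra `A = 𝔽₂[x]/(x²)`. -/
inductive Label
  | one
  | x
  deriving DecidableEq

instance : Fintype Label := ⟨{.one, .x}, by rintro (_ | _) <;> simp⟩

/-- The coefficient of `c` in the product `a b` in `A`. -/
def mulCoeff : Label → Label → Label → ZMod 2
  | .one, .one, .one => 1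
  | .one, .x, .x => 1
  | .x, .one, .x => 1
  | _, _, _ => 0

/-- The coefficient of `b ⊗ c` in `Δ(a)`, where `Δ(1) = x ⊗ 1 + 1 ⊗ x` and `Δ(x) = x ⊗ x`. -/
def comulCoeff : Label → Label → Label → ZMod 2
  | .one, .x, .one => 1
  | .one, .one, .x => 1
  | .x, .x, .x => 1
  | _, _, _ => 0

namespace Shadow

variable {V : Type*} [Fintype V]

/-- The degree `#{α | ρ α = 1} - #{α | ρ α = x}` of a labelling of the circles by `1` and `x`. -/
noncomputable def labelDegree (S : Shadow V) {σ : V → Smoothing} (ρ : S.Circles σ → Label) : ℤ :=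
  (Nat.card {α // ρ α = .one} : ℤ) - (Nat.card {α // ρ α = .x} : ℤ)

open scoped Classical in
/-- The matrix entry, from the basis vector `⨂ ρ(α)` of `A^{⊗ circles of σ}` to the basis vector
`⨂ ρ'(α)` of `A^{⊗ circles of σ'}`, of the map that the TQFT assigns to the saddle cobordism at `v`,
where `σ'` is obtained from `σ` by exchanging the smoothing at `v`. For either smoothing, one of the
two arcs at `v` belongs to the edge arriving from the lower left, and the other one belongs to the
edge leaving to the upper right. The map is the multiplication if the saddle merges two circles and
the comultiplication if it splits a circle; circles not meeting `v` are unchanged. -/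
noncomputable def saddleCoeff (S : Shadow V) (v : V) {σ σ' : V → Smoothing}
    (ρ : S.Circles σ → Label) (ρ' : S.Circles σ' → Label) : ZMod 2 :=
  let p := S.circle σ (S.inEdge v .left)
  let q := S.circle σ (S.outEdge v .right)
  let p' := S.circle σ' (S.inEdge v .left)
  let q' := S.circle σ' (S.outEdge v .right)
  if ∀ e : S.Edge, S.circle σ e ≠ p → S.circle σ e ≠ q → ρ' (S.circle σ' e) = ρ (S.circle σ e) then
    if p ≠ q ∧ p' = q' then mulCoeff (ρ p) (ρ q) (ρ' p')
    else if p = q ∧ p' ≠ q' then comulCoeff (ρ p) (ρ' p') (ρ' q')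
    else 0
  else 0

variable [DecidableEq V]

/-- An enhanced state of the link diagram with shadow `S` and crossing signs `ε`: a state `s` and a
labelling of the circles of the corresponding smoothing by `1` and `x`. -/
abbrev EnhancedState (S : Shadow V) (ε : V → CrossingSign) : Type _ :=
  Σ s : Finset V, (S.Circles (stateSmoothing ε s) → Label)

/-- The homological degree `|s| - n_-` of an enhanced state. -/
def homDegree (S : Shadow V) {ε : V → CrossingSign} (a : S.EnhancedState ε) : ℤ :=
  (a.1.card : ℤ) - (numSign ε .neg : ℤ)

/-- The quantum degree `deg(s, ρ) + |s| + n_+ - 2 n_-` of an enhanced state. -/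
noncomputable def quantumDegree (S : Shadow V) {ε : V → CrossingSign} (a : S.EnhancedState ε) : ℤ :=
  S.labelDegree a.2 + (a.1.card : ℤ) + (numSign ε .pos : ℤ) - 2 * (numSign ε .neg : ℤ)

/-- The matrix entry from `a` to `a'` of the Khovanov differential `∑_c δ_c` over `𝔽₂` (so without
signs), where `δ_c` is the saddle from the `0`-smoothing to the `1`-smoothing of the crossing `c`.
It is meant for `ε = ε'`. -/
noncomputable def diffCoeff (S : Shadow V) {ε ε' : V → CrossingSign}
    (a : S.EnhancedState ε) (a' : S.EnhancedState ε') : ZMod 2 :=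
  ∑ c : V, if c ∉ a.1 ∧ a'.1 = insert c a.1 then S.saddleCoeff c a.2 a'.2 else 0

/-- The matrix entry from `a` to `a'` of the genus-one map over `𝔽₂` at `b`, where the crossing `b` is
negative for `ε` and positive for `ε'`, and all other signs agree. It vanishes on the `0`-smoothing
of the negative crossing, and it maps the `1`-smoothing of the negative crossing to the
`0`-smoothing of the positive crossing (both are the vertical smoothing) by the cobordism composed
of the saddle from the vertical to the horizontal smoothing and the saddle back. -/
noncomputable def genusOneCoeff (S : Shadow V) (b : V) {ε ε' : V → CrossingSign}
    (a : S.EnhancedState ε) (a' : S.EnhancedState ε') : ZMod 2 :=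
  if b ∈ a.1 ∧ a'.1 = a.1.erase b then
    ∑ᶠ τ : S.Circles (Function.update (stateSmoothing ε a.1) b .horiz) → Label,
      S.saddleCoeff b a.2 τ * S.saddleCoeff b τ a'.2
  else 0

end Shadow

namespace SingularLinkDiagram

variable {V : Type*} [Fintype V] [DecidableEq V]

/-- The basis of `⨁_A C(D_A) ⊗ 𝔽₂`, where `A` runs over the sets of double points: pairs of a set
`A` and an enhanced state of the link diagram `D_A`. -/
abbrev Generator (D : SingularLinkDiagram V) : Type _ :=
  Σ A : {A : Finset V // A ⊆ D.doublePoints}, D.shadow.EnhancedState (D.signOf A)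

/-- The homological degree in the multiple mapping cone `⨁_A C(D_A)[-(r - |A|)]`, where
`W[-k]^i = W^{i+k}` and `r` is the number of double points. -/
def homDegree (D : SingularLinkDiagram V) (a : D.Generator) : ℤ :=
  D.shadow.homDegree a.2 - ((D.doublePoints.card : ℤ) - (a.1.1.card : ℤ))

/-- The quantum degree in the multiple mapping cone. -/
noncomputable def quantumDegree (D : SingularLinkDiagram V) (a : D.Generator) : ℤ :=
  D.shadow.quantumDegree a.2

/-- The matrix entry from `a` to `a'` of the differential of the multiple mapping cone over `𝔽₂` (so
without signs) of the cube of complexes `C(D_A) ⊗ 𝔽₂` and genus-one maps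
`C(D_A) ⊗ 𝔽₂ → C(D_{A ∪ {b}}) ⊗ 𝔽₂`: on the summand of `A` it is the sum of the differential of
`C(D_A) ⊗ 𝔽₂` and of the genus-one maps at the double points `b ∉ A`. -/
noncomputable def coneCoeff (D : SingularLinkDiagram V) (a a' : D.Generator) : ZMod 2 :=
  (if a'.1.1 = a.1.1 then D.shadow.diffCoeff a.2 a'.2 else 0) +
    ∑ b ∈ D.doublePoints,
      if b ∉ a.1.1 ∧ a'.1.1 = insert b a.1.1 then D.shadow.genusOneCoeff b a.2 a'.2 else 0

/-- The generators of bidegree `(i, j)`. -/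
abbrev GeneratorOf (D : SingularLinkDiagram V) (i j : ℤ) : Type _ :=
  {a : D.Generator // D.homDegree a = i ∧ D.quantumDegree a = j}

noncomputable instance (D : SingularLinkDiagram V) (i j : ℤ) : Fintype (D.GeneratorOf i j) :=
  Fintype.ofFinite _

/-- The group `C^{i,j}(D; 𝔽₂)` of the Khovanov complex of a singular link diagram: the vector space
with basis the generators of bidegree `(i, j)`. -/
abbrev Chain (D : SingularLinkDiagram V) (i j : ℤ) : Type _ := D.GeneratorOf i j → ZMod 2

/-- The differential `C^{i,j}(D; 𝔽₂) → C^{i',j}(D; 𝔽₂)`, of interest for `i' = i + 1`. -/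
noncomputable def diff (D : SingularLinkDiagram V) (i i' j : ℤ) :
    D.Chain i j →ₗ[ZMod 2] D.Chain i' j :=
  Matrix.mulVecLin (Matrix.of fun a' a => D.coneCoeff a.1 a'.1)

/-- The Khovanov homology `Kh^{i,j}(D; 𝔽₂)`: cocycles modulo coboundaries. -/
abbrev Kh (D : SingularLinkDiagram V) (i j : ℤ) : Type _ :=
  LinearMap.ker (D.diff i (i + 1) j) ⧸
    (LinearMap.range (D.diff (i - 1) i j)).submoduleOf (LinearMap.ker (D.diff i (i + 1) j))

/-- The graded Euler characteristic `∑_{i,j} (-1)^i q^j dim Kh^{i,j}(D; 𝔽₂)` (a finite sum). -/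
noncomputable def khEuler (D : SingularLinkDiagram V) : ℤ[T;T⁻¹] :=
  ∑ᶠ p : ℤ × ℤ, LaurentPolynomial.C
      ((Int.negOnePow p.1 : ℤ) * (Module.finrank (ZMod 2) (D.Kh p.1 p.2) : ℤ)) *
    LaurentPolynomial.T p.2

end SingularLinkDiagram

/-! The Euler characteristic of a finite-dimensional complex is that of its chain groups. Grouping
the generators by `A`, the chains contribute `∑_A (-1)^(r - |A|) V(D_A)`, with the sign from the
shift in the cone and each `V(D_A)` the state sum of the Jones polynomial. The Vassiliev skein
relation, unrolled over all double points, gives the same alternating sum in whatever order they are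
resolved. What remains is that the cone differential squares to zero and preserves the quantum
degree.

For the square, chains are represented by polynomials over `𝔽₂` in one variable per edge: at a given
smoothing every edge variable becomes the variable of its circle, and only squarefree coefficients
are read off, so that squares count as zero. Let `a_v` be the sum of the variables of the two arcs
at `v`. A saddle at `v` is multiplication by `1` if it merges two circles and by `a_v` otherwise
(`sum_saddleCoeff`); the genus-one map at `b` is multiplication by `a_b`
(`sum_saddleCoeff_mul_saddleCoeff`). Multiplications commute, so two components of the differential
commute once their factors are compared. Only the factor of a saddle depends on the smoothing, and
`saddleFactor_comm` treats this dependence. At one and the same double point both composites of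
saddle and genus-one map vanish, because `a_b` becomes zero after a merge and `a_b ^ 2 = 0` in
characteristic 2 (`coeffAt_saddleFactor_arcSum`). Hence the composites cancel in pairs.

The topological input is `circle_eq_of_flip`: if the arcs at a vertex lie on two circles, changing
the smoothing there joins them into one. -/

/-! ## Circles of smoothings that differ at one vertex -/

namespace Shadow

variable {V : Type*} [Fintype V]

/-- The smoothings `σ` and `σ'` differ exactly at `v`. -/
def Flip (v : V) (σ σ' : V → Smoothing) : Prop :=
  σ v ≠ σ' v ∧ ∀ w, w ≠ v → σ w = σ' w

omit [Fintype V] in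
theorem Flip.symm {v : V} {σ σ' : V → Smoothing} (h : Flip v σ σ') : Flip v σ' σ :=
  ⟨h.1.symm, fun w hw => (h.2 w hw).symm⟩

/-- The edge arriving from the lower left. -/
abbrev lowEdge (S : Shadow V) (v : V) : S.Edge := S.inEdge v .left

/-- The edge leaving to the upper right. -/
abbrev highEdge (S : Shadow V) (v : V) : S.Edge := S.outEdge v .right

variable (S : Shadow V) {σ σ' : V → Smoothing}

theorem circle_eq_of_joined {v : V} {e e' : S.Edge} (h : S.Joined v (σ v) e e') :
    S.circle σ e = S.circle σ e' :=
  Quot.sound ⟨v, h⟩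

theorem circle_surjective (σ : V → Smoothing) : Function.Surjective (S.circle σ) :=
  Quot.mk_surjective

/-- Induction along a chain of joined edges, in the form that an invariant property descends to the
quotient. -/
theorem iff_of_circle_eq (P : S.Edge → Prop)
    (hP : ∀ v e e', S.Joined v (σ v) e e' → (P e ↔ P e')) {e e' : S.Edge}
    (h : S.circle σ e = S.circle σ e') : P e ↔ P e' := by
  let Q : S.Circles σ → Prop :=
    Quot.lift P fun a b ⟨v, hv⟩ => propext (hP v a b hv)
  have : Q (S.circle σ e) = Q (S.circle σ e') := by rw [h]
  exact iff_of_eq this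

/-- The circle `c` passes through the vertex `v`. -/
def Meets (v : V) (c : S.Circles σ) : Prop :=
  c = S.circle σ (S.lowEdge v) ∨ c = S.circle σ (S.highEdge v)

theorem meets_inEdge (σ : V → Smoothing) (v : V) (b : Side) :
    S.Meets v (S.circle σ (S.inEdge v b)) := by
  cases b
  · exact Or.inl rfl
  · cases h : σ v
    · exact Or.inr (S.circle_eq_of_joined (v := v) (h ▸ Joined.vert .right))
    · exact Or.inl (S.circle_eq_of_joined (v := v) (h ▸ Joined.lower)).symm

theorem meets_outEdge (σ : V → Smoothing) (v : V) (b : Side) :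
    S.Meets v (S.circle σ (S.outEdge v b)) := by
  cases b
  · cases h : σ v
    · exact Or.inl (S.circle_eq_of_joined (v := v) (h ▸ Joined.vert .left)).symm
    · exact Or.inr (S.circle_eq_of_joined (v := v) (h ▸ Joined.upper))
  · exact Or.inr rfl

theorem meets_of_joined (σ : V → Smoothing) {v : V} {t : Smoothing} {e e' : S.Edge}
    (h : S.Joined v t e e') : S.Meets v (S.circle σ e) ∧ S.Meets v (S.circle σ e') := by
  cases h <;> exact ⟨by first | apply meets_inEdge | apply meets_outEdge,
    by first | apply meets_inEdge | apply meets_outEdge⟩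

/-- Follow the `σ`-circle from `e`: away from `v` the joins are also joins of `σ'`, and each passage
through `v` lands on a `σ'`-circle that meets `v`. -/
theorem circle_eq_or_meets {v : V} (h : Flip v σ σ') {e e' : S.Edge}
    (he : S.circle σ e = S.circle σ e') :
    S.circle σ' e = S.circle σ' e' ∨
      (S.Meets v (S.circle σ' e) ∧ S.Meets v (S.circle σ' e')) := by
  have := (S.iff_of_circle_eq (fun x => S.circle σ' e = S.circle σ' x ∨
      (S.Meets v (S.circle σ' e) ∧ S.Meets v (S.circle σ' x))) ?_ he).1 (Or.inl rfl)
  · exact this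
  · intro w x y hxy
    by_cases hw : w = v
    · subst hw
      obtain ⟨hx, hy⟩ := S.meets_of_joined σ' hxy
      constructor
      · rintro (h1 | h1)
        · exact Or.inr ⟨h1 ▸ hx, hy⟩
        · exact Or.inr ⟨h1.1, hy⟩
      · rintro (h1 | h1)
        · exact Or.inr ⟨h1 ▸ hy, hx⟩
        · exact Or.inr ⟨h1.1, hx⟩
    · rw [h.2 w hw] at hxy
      rw [S.circle_eq_of_joined hxy]

/-- A set of edges that contains, at every vertex but `v`, both or none of two ends joined in `σ`,
contains an even number of the ends at `v`. -/
theorem sum_ends_eq_zero (v : V) (N : S.Edge → ZMod 2)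
    (hN : ∀ w, w ≠ v → ∀ e e', S.Joined w (σ w) e e' → N e = N e') :
    N (S.inEdge v .left) + N (S.inEdge v .right) + N (S.outEdge v .left)
      + N (S.outEdge v .right) = 0 := by
  classical
  have huniv : (Finset.univ : Finset Side) = {.left, .right} := rfl
  -- Every edge of the graph has one initial and one terminal end, so it is counted twice in the sum
  -- over all vertices.
  have key : ∑ w, (∑ b, N (S.inEdge w b) + ∑ b, N (S.outEdge w b)) = 0 := by
    rw [Finset.sum_add_distrib, ← Fintype.sum_prod_type' (f := fun w b => N (S.inEdge w b)),
      ← Fintype.sum_prod_type' (f := fun w b => N (S.outEdge w b))]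
    have := Equiv.sum_comp S.next.symm (fun z : V × Side => N (.inl z))
    simp only [inEdge, outEdge]
    rw [this]
    exact CharTwo.add_self_eq_zero _
  rw [Finset.sum_eq_single v] at key
  · rw [huniv] at key
    simpa [add_assoc] using key
  · intro w _ hw
    have h1 := hN w hw
    rw [huniv]
    simp only [Finset.mem_singleton, reduceCtorEq, not_false_eq_true, Finset.sum_insert,
      Finset.sum_singleton]
    cases h : σ w <;> rw [h] at h1
    · rw [h1 _ _ (Joined.vert .left), h1 _ _ (Joined.vert .right)]
      exact CharTwo.add_self_eq_zero _
    · rw [h1 _ _ Joined.lower, h1 _ _ Joined.upper, CharTwo.add_self_eq_zero,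
        CharTwo.add_self_eq_zero, add_zero]
  · simp

theorem circle_eq_of_flip_vert {v : V} (h : Flip v σ σ') (hv : σ v = .vert)
    (hne : S.circle σ (S.lowEdge v) ≠ S.circle σ (S.highEdge v)) :
    S.circle σ' (S.lowEdge v) = S.circle σ' (S.highEdge v) := by
  classical
  by_contra hne'
  have hv' : σ' v = .horiz := by
    have := h.1
    rw [hv] at this
    cases h' : σ' v
    · exact absurd h'.symm this
    · rfl
  -- If both smoothings separated the two arcs, the edges lying on the circle of `lowEdge v` for
  -- both would contain exactly one of the four ends at `v`, against parity.
  let K : S.Edge → Prop := fun x => S.circle σ x = S.circle σ (S.lowEdge v) ∧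
    S.circle σ' x = S.circle σ' (S.lowEdge v)
  have h0 := S.sum_ends_eq_zero (σ := σ) v (fun x => if K x then 1 else 0) (by
    intro w hw e e' hj
    have h1 := S.circle_eq_of_joined hj
    have h2 : S.circle σ' e = S.circle σ' e' := by
      rw [h.2 w hw] at hj
      exact S.circle_eq_of_joined hj
    simp only [K, h1, h2])
  have k1 : K (S.inEdge v .left) := ⟨rfl, rfl⟩
  have k2 : ¬ K (S.inEdge v .right) := fun hk => by
    have := S.circle_eq_of_joined (σ := σ) (v := v) (hv ▸ Joined.vert .right)
    exact hne (hk.1.symm.trans this)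
  have k3 : ¬ K (S.outEdge v .left) := fun hk => by
    have := S.circle_eq_of_joined (σ := σ') (v := v) (hv' ▸ Joined.upper)
    exact hne' (hk.2.symm.trans this)
  have k4 : ¬ K (S.outEdge v .right) := fun hk => hne hk.1.symm
  simp [k1, k2, k3, k4] at h0

theorem circle_eq_of_flip {v : V} (h : Flip v σ σ')
    (hne : S.circle σ (S.lowEdge v) ≠ S.circle σ (S.highEdge v)) :
    S.circle σ' (S.lowEdge v) = S.circle σ' (S.highEdge v) := by
  cases hv : σ v
  · exact S.circle_eq_of_flip_vert h hv hne
  · by_contra hne'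
    refine hne (S.circle_eq_of_flip_vert h.symm ?_ hne')
    have := h.1
    rw [hv] at this
    cases h' : σ' v
    · rfl
    · exact absurd h'.symm this

/-- If the arcs at `v` belong to one circle of `σ'`, then all edges which share a circle of `σ`
share a circle of `σ'`. -/
theorem circle_eq_of_coarser {v : V} (h : Flip v σ σ')
    (hv : S.circle σ' (S.lowEdge v) = S.circle σ' (S.highEdge v)) {e e' : S.Edge}
    (he : S.circle σ e = S.circle σ e') : S.circle σ' e = S.circle σ' e' := by
  rcases S.circle_eq_or_meets h he with h1 | ⟨h1, h2⟩
  · exact h1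
  · have : ∀ c, S.Meets (σ := σ') v c → c = S.circle σ' (S.highEdge v) := by
      rintro c (hc | hc)
      · rw [hc, hv]
      · exact hc
    rw [this _ h1, this _ h2]

end Shadow

/-! ## The algebra `A^{⊗ C}` as a quotient of a polynomial ring -/

theorem Label.eq_one_or_eq_x (l : Label) : l = .one ∨ l = .x := by
  cases l <;> simp

theorem ite_eq_ite_add_ite {P Q R : Prop} [Decidable P] [Decidable Q] [Decidable R]
    (h : P ↔ Q ∨ R) (h' : ¬ (Q ∧ R)) {M : Type*} [AddZeroClass M] (a : M) :
    (if P then a else 0) = (if Q then a else 0) + if R then a else 0 := by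
  by_cases hQ : Q <;> by_cases hR : R <;> simp_all

section Labels

open MvPolynomial

variable {C C' : Type*}

/-- The exponent of the monomial `∏ {c | ρ c = x}, X c`. -/
noncomputable def labelExponent [Finite C] (ρ : C → Label) : C →₀ ℕ :=
  Finsupp.equivFunOnFinite.symm fun c => if ρ c = .x then 1 else 0

theorem labelExponent_apply [Finite C] (ρ : C → Label) (c : C) :
    labelExponent ρ c = if ρ c = .x then 1 else 0 := rfl

/-- The coefficient of the basis vector `ρ` of `A^{⊗ C} = 𝔽₂[X_c]/(X_c²)` in a polynomial. -/
noncomputable def labelCoeff [Finite C] (ρ : C → Label) : MvPolynomial C (ZMod 2) →ₗ[ZMod 2] ZMod 2 :=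
  lcoeff (ZMod 2) (labelExponent ρ)

theorem labelCoeff_apply [Finite C] (ρ : C → Label) (f : MvPolynomial C (ZMod 2)) :
    labelCoeff ρ f = coeff (labelExponent ρ) f := rfl

theorem labelCoeff_X_mul [Finite C] [DecidableEq C] (ρ : C → Label) (p : C)
    (f : MvPolynomial C (ZMod 2)) :
    labelCoeff ρ (X p * f) = if ρ p = .x then labelCoeff (Function.update ρ p .one) f else 0 := by
  classical
  rw [labelCoeff_apply, coeff_X_mul']
  by_cases h : ρ p = .x
  · rw [if_pos h, if_pos (by simp [labelExponent_apply, h]), labelCoeff_apply]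
    congr 1
    ext c
    by_cases hc : c = p
    · subst hc
      simp [labelExponent_apply, h]
    · simp [labelExponent_apply, hc]
  · rw [if_neg h, if_neg (by simp [labelExponent_apply, h])]

/-- Labels correspond to squarefree monomials, so the functionals `labelCoeff ρ` kill the ideal of
the squares `X_c²`. This lets polynomials stand for elements of the quotient without forming it. -/
theorem labelCoeff_X_sq_mul [Finite C] (ρ : C → Label) (p : C)
    (f : MvPolynomial C (ZMod 2)) : labelCoeff ρ (X p * (X p * f)) = 0 := by
  classical
  rw [labelCoeff_X_mul, labelCoeff_X_mul]
  simp

/-- The map `g` identifies the two elements `p ≠ q` and is bijective otherwise. -/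
structure IsMerge (g : C → C') (p q : C) : Prop where
  ne : p ≠ q
  surjective : Function.Surjective g
  map_eq : g p = g q
  eq_or {c d : C} : g c = g d → c = d ∨ ((c = p ∨ c = q) ∧ (d = p ∨ d = q))

namespace IsMerge

variable {g : C → C'} {p q : C}

theorem map_ne (h : IsMerge g p q) {c : C} (hp : c ≠ p) (hq : c ≠ q) : g c ≠ g p := by
  intro hc
  rcases h.eq_or hc with h1 | ⟨h1 | h1, -⟩
  exacts [hp h1, hp h1, hq h1]

theorem mapDomain_apply (h : IsMerge g p q) (n : C →₀ ℕ) {c : C} (hp : c ≠ p) (hq : c ≠ q) :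
    n.mapDomain g (g c) = n c := by
  classical
  induction n using Finsupp.induction_linear with
  | zero => simp
  | add a b ha hb => simp [Finsupp.mapDomain_add, ha, hb]
  | single d k =>
    rw [Finsupp.mapDomain_single, Finsupp.single_apply, Finsupp.single_apply]
    refine if_congr ⟨fun hd => ?_, fun hd => hd ▸ rfl⟩ rfl rfl
    rcases h.eq_or hd with h1 | ⟨-, h1 | h1⟩
    exacts [h1, absurd h1 hp, absurd h1 hq]

theorem mapDomain_apply_merged (h : IsMerge g p q) (n : C →₀ ℕ) :
    n.mapDomain g (g p) = n p + n q := by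
  classical
  induction n using Finsupp.induction_linear with
  | zero => simp
  | add a b ha hb => simp only [Finsupp.mapDomain_add, Finsupp.add_apply, ha, hb]; ring
  | single d k =>
    rw [Finsupp.mapDomain_single, Finsupp.single_apply, Finsupp.single_apply, Finsupp.single_apply]
    by_cases hp : d = p
    · subst hp
      simp [h.ne]
    · by_cases hq : d = q
      · subst hq
        simp [h.map_eq, h.ne.symm]
      · simp [hp, hq, h.map_ne hp hq]

theorem mapDomain_eq_labelExponent_iff [Finite C] [Finite C'] (h : IsMerge g p q) (n : C →₀ ℕ)
    (ρ' : C' → Label) : n.mapDomain g = labelExponent ρ' ↔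
      (∀ c, c ≠ p → c ≠ q → n c = labelExponent ρ' (g c)) ∧
        n p + n q = labelExponent ρ' (g p) := by
  constructor
  · intro hn
    rw [← hn]
    exact ⟨fun c hp hq => (h.mapDomain_apply n hp hq).symm, (h.mapDomain_apply_merged n).symm⟩
  · rintro ⟨h1, h2⟩
    ext c'
    obtain ⟨c, rfl⟩ := h.surjective c'
    by_cases hp : c = p
    · rw [hp, h.mapDomain_apply_merged, h2]
    · by_cases hq : c = q
      · rw [hq, ← h.map_eq, h.mapDomain_apply_merged, h2]
      · rw [h.mapDomain_apply n hp hq, h1 c hp hq]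

theorem labelCoeff_rename_of_one [Finite C] [Finite C'] (h : IsMerge g p q) (ρ' : C' → Label)
    (hρ : ρ' (g p) = .one) (f : MvPolynomial C (ZMod 2)) :
    labelCoeff ρ' (rename g f) = labelCoeff (ρ' ∘ g) f := by
  classical
  induction f using MvPolynomial.induction_on' with
  | add a b ha hb => rw [map_add, map_add, map_add, ha, hb]
  | monomial n a =>
    rw [rename_monomial, labelCoeff_apply, labelCoeff_apply, coeff_monomial, coeff_monomial]
    refine if_congr ?_ rfl rfl
    -- The exponents at `p` and `q` add up to the exponent at the merged point; here that is `0`, so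
    -- both vanish.
    rw [h.mapDomain_eq_labelExponent_iff, labelExponent_apply, hρ]
    constructor
    · rintro ⟨h1, h2⟩
      ext c
      by_cases hp : c = p
      · subst hp
        simp only [labelExponent_apply, Function.comp, hρ]
        simp at h2 ⊢
        omega
      · by_cases hq : c = q
        · subst hq
          simp only [labelExponent_apply, Function.comp, ← h.map_eq, hρ]
          simp at h2 ⊢
          omega
        · rw [h1 c hp hq]; rfl
    · rintro rfl
      refine ⟨fun c _ _ => rfl, ?_⟩
      simp [labelExponent_apply, ← h.map_eq, hρ]

theorem labelCoeff_rename_of_x [Finite C] [Finite C'] [DecidableEq C] (h : IsMerge g p q)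
    (ρ' : C' → Label) (hρ : ρ' (g p) = .x) (f : MvPolynomial C (ZMod 2)) :
    labelCoeff ρ' (rename g f) = labelCoeff (Function.update (ρ' ∘ g) p .one) f +
      labelCoeff (Function.update (ρ' ∘ g) q .one) f := by
  have := Classical.decEq C'
  induction f using MvPolynomial.induction_on' with
  | add a b ha hb => simp only [map_add, ha, hb]; ring
  | monomial n a =>
    have hq : ρ' (g q) = .x := h.map_eq ▸ hρ
    have hpq := h.ne
    -- The exponents at `p` and `q` now add up to `1`, so exactly one of them is `1`. The two
    -- possibilities are treated at once, with `r` the point of exponent `0` and `s` the other.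
    have key : ∀ r s, (r = p ∧ s = q) ∨ (r = q ∧ s = p) →
        (n = labelExponent (Function.update (ρ' ∘ g) r .one) ↔
        (∀ c, c ≠ p → c ≠ q → n c = labelExponent ρ' (g c)) ∧ n r = 0 ∧ n s = 1) := by
      intro r s hrs
      have hs : ρ' (g s) = .x := by rcases hrs with ⟨rfl, rfl⟩ | ⟨rfl, rfl⟩ <;> assumption
      have hne : s ≠ r := by
        rcases hrs with ⟨rfl, rfl⟩ | ⟨rfl, rfl⟩
        exacts [hpq.symm, hpq]
      constructor
      · rintro rfl
        refine ⟨fun c hp hq => ?_, ?_, ?_⟩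
        · have : c ≠ r := by rcases hrs with ⟨rfl, rfl⟩ | ⟨rfl, rfl⟩ <;> assumption
          simp [labelExponent_apply, this]
        · simp [labelExponent_apply]
        · simp [labelExponent_apply, hne, hs]
      · rintro ⟨h1, h2, h3⟩
        ext c
        by_cases hr : c = r
        · subst hr
          simp [labelExponent_apply, h2]
        · by_cases hs' : c = s
          · subst hs'
            simp [labelExponent_apply, hr, hs, h3]
          · rw [h1 c (by rcases hrs with ⟨rfl, rfl⟩ | ⟨rfl, rfl⟩ <;> assumption)
              (by rcases hrs with ⟨rfl, rfl⟩ | ⟨rfl, rfl⟩ <;> assumption)]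
            simp [labelExponent_apply, hr]
    rw [rename_monomial, labelCoeff_apply, labelCoeff_apply, labelCoeff_apply, coeff_monomial,
      coeff_monomial, coeff_monomial]
    have h1 : labelExponent ρ' (g p) = 1 := by simp [labelExponent_apply, hρ]
    have hP := h.mapDomain_eq_labelExponent_iff n ρ'
    have hQ := key p q (Or.inl ⟨rfl, rfl⟩)
    have hR := key q p (Or.inr ⟨rfl, rfl⟩)
    rw [h1] at hP
    refine ite_eq_ite_add_ite ?_ ?_ a
    · rw [hP, hQ, hR, ← and_or_left, and_congr_right_iff]
      intro _
      omega
    · rw [hQ, hR]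
      rintro ⟨⟨-, h2, -⟩, -, -, h3⟩
      omega

open scoped Classical in
/-- The matrix of the multiplication map `A^{⊗ C} → A^{⊗ C'}`. -/
noncomputable def mulMatrix (g : C → C') (p q : C) (ρ : C → Label) (ρ' : C' → Label) : ZMod 2 :=
  if ∀ c, c ≠ p → c ≠ q → ρ' (g c) = ρ c then mulCoeff (ρ p) (ρ q) (ρ' (g p)) else 0

open scoped Classical in
/-- The matrix of the comultiplication map `A^{⊗ C'} → A^{⊗ C}`. -/
noncomputable def comulMatrix (g : C → C') (p q : C) (ρ' : C' → Label) (ρ : C → Label) : ZMod 2 :=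
  if ∀ c, c ≠ p → c ≠ q → ρ c = ρ' (g c) then comulCoeff (ρ' (g p)) (ρ p) (ρ q) else 0

open scoped Classical in
theorem mulMatrix_of_one (h : IsMerge g p q) {ρ' : C' → Label} (hρ : ρ' (g p) = .one)
    (ρ : C → Label) : mulMatrix g p q ρ ρ' = if ρ = ρ' ∘ g then 1 else 0 := by
  have hq : ρ' (g q) = .one := h.map_eq ▸ hρ
  unfold mulMatrix
  by_cases hc : ρ = ρ' ∘ g
  · subst hc
    simp [hρ, hq, mulCoeff]
  · rw [if_neg hc]
    split_ifs with h1
    · rw [hρ]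
      rcases (ρ p).eq_one_or_eq_x with h2 | h2 <;> rcases (ρ q).eq_one_or_eq_x with h3 | h3 <;>
        rw [h2, h3] <;> try rfl
      refine absurd (funext fun c => ?_) hc
      by_cases hp : c = p
      · rw [hp, h2, Function.comp, hρ]
      · by_cases hq' : c = q
        · rw [hq', h3, Function.comp, hq]
        · exact (h1 c hp hq').symm
    · rfl

open scoped Classical in
theorem mulMatrix_of_x (h : IsMerge g p q) {ρ' : C' → Label} (hρ : ρ' (g p) = .x)
    (ρ : C → Label) : mulMatrix g p q ρ ρ' = (if ρ = Function.update (ρ' ∘ g) p .one then 1 else 0) +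
      if ρ = Function.update (ρ' ∘ g) q .one then 1 else 0 := by
  have hq : ρ' (g q) = .x := h.map_eq ▸ hρ
  have hpq := h.ne
  have e1 : ρ = Function.update (ρ' ∘ g) p .one ↔
      (∀ c, c ≠ p → c ≠ q → ρ' (g c) = ρ c) ∧ ρ p = .one ∧ ρ q = .x := by
    constructor
    · rintro rfl
      refine ⟨fun c h1 _ => by simp [h1], by simp, by simp [hpq.symm, hq]⟩
    · rintro ⟨h1, h2, h3⟩
      funext c
      by_cases hp : c = p
      · subst hp; simp [h2]
      · by_cases hq' : c = q
        · subst hq'; simp [hp, h3, hq]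
        · simp [hp, h1 c hp hq']
  have e2 : ρ = Function.update (ρ' ∘ g) q .one ↔
      (∀ c, c ≠ p → c ≠ q → ρ' (g c) = ρ c) ∧ ρ p = .x ∧ ρ q = .one := by
    constructor
    · rintro rfl
      refine ⟨fun c _ h1 => by simp [h1], by simp [hpq, hρ], by simp⟩
    · rintro ⟨h1, h2, h3⟩
      funext c
      by_cases hq' : c = q
      · subst hq'; simp [h3]
      · by_cases hp : c = p
        · subst hp; simp [hq', h2, hρ]
        · simp [hq', h1 c hp hq']
  unfold mulMatrix
  simp only [e1, e2, hρ]
  generalize (∀ c, c ≠ p → c ≠ q → ρ' (g c) = ρ c) = P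
  by_cases hP : P <;> rcases ρ p with _ | _ <;> rcases ρ q with _ | _ <;> simp [hP, mulCoeff]

variable [Finite C] [Finite C']

theorem sum_mulMatrix [Fintype (C → Label)] (h : IsMerge g p q) (ρ' : C' → Label) (f : MvPolynomial C (ZMod 2)) :
    ∑ ρ, labelCoeff ρ f * mulMatrix g p q ρ ρ' = labelCoeff ρ' (rename g f) := by
  classical
  rcases (ρ' (g p)).eq_one_or_eq_x with hρ | hρ
  · simp [h.mulMatrix_of_one hρ, h.labelCoeff_rename_of_one ρ' hρ]
  · simp [h.mulMatrix_of_x hρ, h.labelCoeff_rename_of_x ρ' hρ, mul_add, Finset.sum_add_distrib]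

/-- Comultiplication is a bimodule map, so merging and then splitting is multiplication by `Δ(1) = X
p + X q`. Applying it to `rename g f` loses nothing, since `rename g` is surjective. -/
theorem sum_comulMatrix [Fintype (C' → Label)] (h : IsMerge g p q) (ρ : C → Label) (f : MvPolynomial C (ZMod 2)) :
    ∑ ρ', labelCoeff ρ' (rename g f) * comulMatrix g p q ρ' ρ
      = labelCoeff ρ ((X p + X q) * f) := by
  classical
  have hpq := h.ne
  -- A labelling of `C'` that agrees with `ρ` off the merged point is determined by its value there.
  have hext : ∀ l : Label, ∃ ρ₀ : C' → Label, (∀ c, c ≠ p → c ≠ q → ρ c = ρ₀ (g c)) ∧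
      ρ₀ (g p) = l ∧ ∀ ρ', (∀ c, c ≠ p → c ≠ q → ρ c = ρ' (g c)) → ρ' (g p) = l → ρ' = ρ₀ := by
    intro l
    obtain ⟨k, hk⟩ := h.surjective.hasRightInverse
    have hkc : ∀ c, c ≠ p → c ≠ q → k (g c) = c := by
      intro c hp hq
      rcases h.eq_or (hk (g c)) with h1 | ⟨-, h1 | h1⟩
      exacts [h1, absurd h1 hp, absurd h1 hq]
    refine ⟨fun c' => if c' = g p then l else ρ (k c'), fun c hp hq => ?_, ?_, ?_⟩
    · simp only [if_neg (h.map_ne hp hq), hkc c hp hq]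
    · simp
    · intro ρ' h1 h2
      funext c'
      obtain ⟨c, rfl⟩ := h.surjective c'
      by_cases hc : g c = g p
      · rw [if_pos hc, hc, h2]
      · have hp : c ≠ p := fun h' => hc (h' ▸ rfl)
        have hq : c ≠ q := fun h' => hc (h' ▸ h.map_eq.symm)
        rw [if_neg hc, hkc c hp hq, h1 c hp hq]
  -- Unless `ρ p` and `ρ q` are both `1`, the vector `ρ p ⊗ ρ q` occurs in `Δ` of exactly one basis
  -- element `l`, and a single term of the sum survives.
  have hsum : ∀ l : Label, (∀ k, comulCoeff k (ρ p) (ρ q) = if k = l then 1 else 0) →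
      ∃ ρ₀ : C' → Label, (∀ c, c ≠ p → c ≠ q → ρ c = ρ₀ (g c)) ∧ ρ₀ (g p) = l ∧
        ∑ ρ', labelCoeff ρ' (rename g f) * comulMatrix g p q ρ' ρ = labelCoeff ρ₀ (rename g f) := by
    intro l hl
    obtain ⟨ρ₀, h1, h2, h3⟩ := hext l
    refine ⟨ρ₀, h1, h2, ?_⟩
    rw [Finset.sum_eq_single ρ₀]
    · unfold comulMatrix
      rw [if_pos h1, h2, hl, if_pos rfl, mul_one]
    · intro ρ' _ hne
      unfold comulMatrix
      split_ifs with h4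
      · rw [hl, if_neg fun h5 => hne (h3 ρ' h4 h5), mul_zero]
      · rw [mul_zero]
    · simp
  rw [add_mul, map_add, labelCoeff_X_mul, labelCoeff_X_mul]
  rcases hp : ρ p with _ | _ <;> rcases hq : ρ q with _ | _
  · simp only [reduceCtorEq, if_false, add_zero]
    refine Finset.sum_eq_zero fun ρ' _ => ?_
    unfold comulMatrix
    rw [hp, hq]
    rcases ρ' (g p) with _ | _ <;> simp [comulCoeff]
  · obtain ⟨ρ₀, h1, h2, h3⟩ := hsum .one (by rw [hp, hq]; rintro (_ | _) <;> simp [comulCoeff])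
    rw [h3, h.labelCoeff_rename_of_one ρ₀ h2]
    simp only [reduceCtorEq, if_false, if_true, zero_add]
    congr 1
    congr 1
    funext c
    by_cases hcq : c = q
    · subst hcq; simp [← h.map_eq, h2]
    · by_cases hcp : c = p
      · subst hcp; simp [h2, hcq, hp]
      · simp [hcq, h1 c hcp hcq]
  · obtain ⟨ρ₀, h1, h2, h3⟩ := hsum .one (by rw [hp, hq]; rintro (_ | _) <;> simp [comulCoeff])
    rw [h3, h.labelCoeff_rename_of_one ρ₀ h2]
    simp only [reduceCtorEq, if_false, if_true, add_zero]
    congr 1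
    congr 1
    funext c
    by_cases hcp : c = p
    · subst hcp; simp [h2]
    · by_cases hcq : c = q
      · subst hcq; simp [← h.map_eq, h2, hcp, hq]
      · simp [hcp, h1 c hcp hcq]
  · obtain ⟨ρ₀, h1, h2, h3⟩ := hsum .x (by rw [hp, hq]; rintro (_ | _) <;> simp [comulCoeff])
    rw [h3, h.labelCoeff_rename_of_x ρ₀ h2]
    have : ρ₀ ∘ g = ρ := by
      funext c
      by_cases hcp : c = p
      · rw [hcp, hp, Function.comp, h2]
      · by_cases hcq : c = q
        · rw [hcq, hq, Function.comp, ← h.map_eq, h2]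
        · exact (h1 c hcp hcq).symm
    simp [this]

end IsMerge

/-- The contribution of a label to the degree. -/
def Label.weight : Label → ℤ
  | .one => 1
  | .x => -1

namespace IsMerge

variable {g : C → C'} {p q : C} [Fintype C] [Fintype C']

theorem sum_sub (h : IsMerge g p q) (F : C → ℤ) (F' : C' → ℤ)
    (hF : ∀ c, c ≠ p → c ≠ q → F c = F' (g c)) :
    ∑ c, F c - F p - F q = ∑ c', F' c' - F' (g p) := by
  classical
  have h1 : ∑ c ∈ (Finset.univ.erase p).erase q, F c = ∑ c' ∈ Finset.univ.erase (g p), F' c' := by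
    refine Finset.sum_bij (fun c _ => g c) ?_ ?_ ?_ ?_
    · intro c hc
      simp only [Finset.mem_erase, Finset.mem_univ, and_true] at hc ⊢
      exact h.map_ne hc.2 hc.1
    · intro c hc d hd hcd
      simp only [Finset.mem_erase, Finset.mem_univ, and_true] at hc hd
      rcases h.eq_or hcd with h1 | ⟨h1 | h1, -⟩
      exacts [h1, absurd h1 hc.2, absurd h1 hc.1]
    · intro c' hc'
      simp only [Finset.mem_erase, Finset.mem_univ, and_true] at hc'
      obtain ⟨c, rfl⟩ := h.surjective c'
      refine ⟨c, ?_, rfl⟩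
      simp only [Finset.mem_erase, Finset.mem_univ, and_true]
      exact ⟨fun h' => hc' (h' ▸ h.map_eq.symm), fun h' => hc' (h' ▸ rfl)⟩
    · intro c hc
      simp only [Finset.mem_erase, Finset.mem_univ, and_true] at hc
      exact hF c hc.2 hc.1
  have h2 := Finset.add_sum_erase Finset.univ F (Finset.mem_univ p)
  have h3 := Finset.add_sum_erase (Finset.univ.erase p) F
    (Finset.mem_erase.2 ⟨h.ne.symm, Finset.mem_univ q⟩)
  have h4 := Finset.add_sum_erase Finset.univ F' (Finset.mem_univ (g p))
  linarith

theorem weight_of_mulMatrix_ne_zero (h : IsMerge g p q) {ρ : C → Label} {ρ' : C' → Label}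
    (hne : mulMatrix g p q ρ ρ' ≠ 0) : ∑ c', (ρ' c').weight = ∑ c, (ρ c).weight - 1 := by
  unfold mulMatrix at hne
  split_ifs at hne with h1
  · have h2 := h.sum_sub (fun c => (ρ c).weight) (fun c' => (ρ' c').weight)
      (fun c hp hq => by rw [h1 c hp hq])
    rcases h3 : ρ p with _ | _ <;> rcases h4 : ρ q with _ | _ <;>
      rcases h5 : ρ' (g p) with _ | _ <;> simp_all [mulCoeff, Label.weight]
  · exact absurd rfl hne

theorem weight_of_comulMatrix_ne_zero (h : IsMerge g p q) {ρ : C → Label} {ρ' : C' → Label}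
    (hne : comulMatrix g p q ρ' ρ ≠ 0) : ∑ c, (ρ c).weight = ∑ c', (ρ' c').weight - 1 := by
  unfold comulMatrix at hne
  split_ifs at hne with h1
  · have h2 := h.sum_sub (fun c => (ρ c).weight) (fun c' => (ρ' c').weight)
      (fun c hp hq => by rw [h1 c hp hq])
    rcases h3 : ρ p with _ | _ <;> rcases h4 : ρ q with _ | _ <;>
      rcases h5 : ρ' (g p) with _ | _ <;> simp_all [comulCoeff, Label.weight]
    all_goals linarith
  · exact absurd rfl hne

end IsMerge

end Labels

/-! ## Saddle maps on polynomials in the edges -/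

namespace Shadow

open MvPolynomial

variable {V : Type*} [Fintype V] (S : Shadow V) {σ σ' : V → Smoothing}

/-- After the flip both arcs lie on one circle, so the `σ'`-circles are a coarsening of the
`σ`-circles; by `circle_eq_or_meets` nothing but the circles through `v` is identified. -/
theorem exists_isMerge {v : V} (h : Flip v σ σ')
    (hne : S.circle σ (S.lowEdge v) ≠ S.circle σ (S.highEdge v)) :
    ∃ g : S.Circles σ → S.Circles σ', (∀ e, g (S.circle σ e) = S.circle σ' e) ∧
      IsMerge g (S.circle σ (S.lowEdge v)) (S.circle σ (S.highEdge v)) := by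
  have hv := S.circle_eq_of_flip h hne
  have hg : ∀ e, S.circle σ' (Quot.out (S.circle σ e)) = S.circle σ' e := fun e =>
    S.circle_eq_of_coarser h hv (Quot.out_eq (S.circle σ e))
  refine ⟨fun c => S.circle σ' (Quot.out c), hg, hne, ?_, ?_, ?_⟩
  · intro c'
    obtain ⟨e, rfl⟩ := S.circle_surjective σ' c'
    exact ⟨S.circle σ e, hg e⟩
  · simp only [hg, hv]
  · intro c d hcd
    obtain ⟨e, rfl⟩ := S.circle_surjective σ c
    obtain ⟨e', rfl⟩ := S.circle_surjective σ d
    simp only [hg] at hcd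
    exact S.circle_eq_or_meets h.symm hcd

theorem saddleCoeff_of_merge {v : V} {g : S.Circles σ → S.Circles σ'}
    (hg : ∀ e, g (S.circle σ e) = S.circle σ' e)
    (hm : IsMerge g (S.circle σ (S.lowEdge v)) (S.circle σ (S.highEdge v)))
    (ρ : S.Circles σ → Label) (ρ' : S.Circles σ' → Label) :
    S.saddleCoeff v ρ ρ' = IsMerge.mulMatrix g (S.circle σ (S.lowEdge v))
      (S.circle σ (S.highEdge v)) ρ ρ' := by
  have hv : S.circle σ' (S.lowEdge v) = S.circle σ' (S.highEdge v) := by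
    rw [← hg, ← hg, hm.map_eq]
  classical
  unfold saddleCoeff IsMerge.mulMatrix
  simp only [hg]
  rw [if_pos (show S.circle σ (S.inEdge v .left) ≠ S.circle σ (S.outEdge v .right) ∧
    S.circle σ' (S.inEdge v .left) = S.circle σ' (S.outEdge v .right) from ⟨hm.ne, hv⟩)]
  refine if_congr ?_ rfl rfl
  constructor
  · intro h c
    obtain ⟨e, rfl⟩ := S.circle_surjective σ c
    rw [hg]
    exact h e
  · intro h e
    have := h (S.circle σ e)
    rwa [hg] at this

theorem saddleCoeff_of_split {v : V} {g : S.Circles σ' → S.Circles σ}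
    (hg : ∀ e, g (S.circle σ' e) = S.circle σ e)
    (hm : IsMerge g (S.circle σ' (S.lowEdge v)) (S.circle σ' (S.highEdge v)))
    (ρ : S.Circles σ → Label) (ρ' : S.Circles σ' → Label) :
    S.saddleCoeff v ρ ρ' = IsMerge.comulMatrix g (S.circle σ' (S.lowEdge v))
      (S.circle σ' (S.highEdge v)) ρ ρ' := by
  have hv : S.circle σ (S.lowEdge v) = S.circle σ (S.highEdge v) := by
    rw [← hg, ← hg, hm.map_eq]
  classical
  unfold saddleCoeff IsMerge.comulMatrix
  simp only [hg]
  rw [if_neg (show ¬ (S.circle σ (S.inEdge v .left) ≠ S.circle σ (S.outEdge v .right) ∧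
    S.circle σ' (S.inEdge v .left) = S.circle σ' (S.outEdge v .right)) from fun h => h.1 hv),
    if_pos (show S.circle σ (S.inEdge v .left) = S.circle σ (S.outEdge v .right) ∧
    S.circle σ' (S.inEdge v .left) ≠ S.circle σ' (S.outEdge v .right) from ⟨hv, hm.ne⟩)]
  refine if_congr ?_ rfl rfl
  constructor
  · intro h c hp hq
    obtain ⟨e, rfl⟩ := S.circle_surjective σ' c
    have := hm.map_ne hp hq
    rw [hg] at this ⊢
    rw [hg] at this
    exact h e this (hv ▸ this)
  · intro h e hp hq
    have := h (S.circle σ' e) (fun h' => hp ?_) (fun h' => hq ?_)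
    · rwa [hg] at this
    · rw [← hg, h', hg]
    · rw [← hg, h', hg]

theorem saddleCoeff_of_single {v : V}
    (hv : S.circle σ (S.lowEdge v) = S.circle σ (S.highEdge v))
    (hv' : S.circle σ' (S.lowEdge v) = S.circle σ' (S.highEdge v))
    (ρ : S.Circles σ → Label) (ρ' : S.Circles σ' → Label) : S.saddleCoeff v ρ ρ' = 0 := by
  unfold saddleCoeff
  simp only [ite_eq_right_iff]
  intro _
  rw [if_neg fun h => h.1 hv, if_neg fun h => h.2 hv']

/-- The coefficient of the basis vector `ρ` in the class of a polynomial in the edges. -/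
noncomputable def coeffAt (ρ : S.Circles σ → Label) :
    MvPolynomial S.Edge (ZMod 2) →ₗ[ZMod 2] ZMod 2 :=
  labelCoeff ρ ∘ₗ (rename (S.circle σ)).toLinearMap

theorem coeffAt_apply (ρ : S.Circles σ → Label) (f : MvPolynomial S.Edge (ZMod 2)) :
    S.coeffAt ρ f = labelCoeff ρ (rename (S.circle σ) f) := rfl

/-- The sum of the variables of the two arcs at `v`. -/
noncomputable def arcSum (v : V) : MvPolynomial S.Edge (ZMod 2) :=
  X (S.lowEdge v) + X (S.highEdge v)

open scoped Classical in
/-- The saddle map at `v` is induced by the multiplication by this polynomial. -/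
noncomputable def saddleFactor (σ : V → Smoothing) (v : V) : MvPolynomial S.Edge (ZMod 2) :=
  if S.circle σ (S.lowEdge v) = S.circle σ (S.highEdge v) then S.arcSum v else 1

theorem rename_arcSum (σ : V → Smoothing) (v : V) : rename (S.circle σ) (S.arcSum v) =
    X (S.circle σ (S.lowEdge v)) + X (S.circle σ (S.highEdge v)) := by
  simp [arcSum]

theorem rename_arcSum_eq_zero {v : V}
    (hv : S.circle σ (S.lowEdge v) = S.circle σ (S.highEdge v)) :
    rename (S.circle σ) (S.arcSum v) = 0 := by
  rw [rename_arcSum, hv, CharTwo.add_self_eq_zero]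

theorem coeffAt_arcSum_mul {v : V}
    (hv : S.circle σ (S.lowEdge v) = S.circle σ (S.highEdge v)) (ρ : S.Circles σ → Label)
    (f : MvPolynomial S.Edge (ZMod 2)) : S.coeffAt ρ (S.arcSum v * f) = 0 := by
  rw [coeffAt_apply, map_mul, S.rename_arcSum_eq_zero hv, zero_mul, map_zero]

theorem coeffAt_arcSum_mul_arcSum_mul (v : V) (ρ : S.Circles σ → Label)
    (f : MvPolynomial S.Edge (ZMod 2)) : S.coeffAt ρ (S.arcSum v * (S.arcSum v * f)) = 0 := by
  have h : ∀ p q : MvPolynomial (S.Circles σ) (ZMod 2), (p + q) * (p + q) = p * p + q * q := by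
    intro p q
    rw [← sq, CharTwo.add_sq, sq, sq]
  rw [coeffAt_apply, ← mul_assoc, map_mul (rename _), map_mul (rename _), rename_arcSum, h, add_mul,
    map_add, mul_assoc, mul_assoc, labelCoeff_X_sq_mul, labelCoeff_X_sq_mul, add_zero]

/-- A merge is a renaming of variables and a split is governed by `Δ(1)`. If one circle stays one
circle, the saddle map is zero by definition, and so is the factor `arcSum v`, whose two variables
coincide at `σ'`. -/
theorem sum_saddleCoeff {v : V} (h : Flip v σ σ') [Fintype (S.Circles σ → Label)]
    (ρ' : S.Circles σ' → Label) (f : MvPolynomial S.Edge (ZMod 2)) :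
    ∑ ρ : S.Circles σ → Label, S.coeffAt ρ f * S.saddleCoeff v ρ ρ' = S.coeffAt ρ' (S.saddleFactor σ v * f) := by
  unfold saddleFactor
  split_ifs with hv
  · by_cases hv' : S.circle σ' (S.lowEdge v) = S.circle σ' (S.highEdge v)
    · rw [S.coeffAt_arcSum_mul hv']
      exact Finset.sum_eq_zero fun ρ _ => by rw [S.saddleCoeff_of_single hv hv', mul_zero]
    · obtain ⟨g, hg, hm⟩ := S.exists_isMerge h.symm hv'
      have hf : rename (S.circle σ) f = rename g (rename (S.circle σ') f) := by
        rw [rename_rename]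
        congr 2
        exact funext fun e => (hg e).symm
      simp only [S.saddleCoeff_of_split hg hm, coeffAt_apply, hf, map_mul, rename_arcSum]
      exact hm.sum_comulMatrix ρ' _
  · obtain ⟨g, hg, hm⟩ := S.exists_isMerge h hv
    have hf : rename (S.circle σ') f = rename g (rename (S.circle σ) f) := by
      rw [rename_rename]
      congr 2
      exact funext fun e => (hg e).symm
    simp only [S.saddleCoeff_of_merge hg hm, coeffAt_apply, hf, one_mul]
    exact hm.sum_mulMatrix ρ' _

/-- After a merge the two variables in `arcSum v` are equal and cancel; otherwise the product
contains the square of `arcSum v`. -/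
theorem coeffAt_saddleFactor_arcSum {v : V} (h : Flip v σ σ') (ρ' : S.Circles σ' → Label)
    (f : MvPolynomial S.Edge (ZMod 2)) :
    S.coeffAt ρ' (S.saddleFactor σ v * (S.arcSum v * f)) = 0 := by
  unfold saddleFactor
  split_ifs with hv
  · exact S.coeffAt_arcSum_mul_arcSum_mul v ρ' f
  · rw [one_mul]
    exact S.coeffAt_arcSum_mul (S.circle_eq_of_flip h hv) ρ' f

/-- If the arcs lie on different circles, the composite is a merge followed by a split. If they lie
on one circle, both sides vanish. The target is a separate `σ'` because in the application the two
smoothings agree only propositionally. -/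
theorem sum_saddleCoeff_mul_saddleCoeff {v : V} {τ : V → Smoothing} (h : Flip v σ τ) (hσ : σ' = σ)
    [Fintype (S.Circles σ → Label)] [Fintype (S.Circles τ → Label)]
    (ρ' : S.Circles σ' → Label) (f : MvPolynomial S.Edge (ZMod 2)) :
    ∑ ρ : S.Circles σ → Label, S.coeffAt ρ f * ∑ t : S.Circles τ → Label, S.saddleCoeff v ρ t * S.saddleCoeff v t ρ' =
      S.coeffAt ρ' (S.arcSum v * f) := by
  subst hσ
  simp only [Finset.mul_sum, ← mul_assoc]
  rw [Finset.sum_comm]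
  simp only [← Finset.sum_mul]
  simp only [S.sum_saddleCoeff h, S.sum_saddleCoeff h.symm]
  by_cases hv : S.circle σ' (S.lowEdge v) = S.circle σ' (S.highEdge v)
  · have : S.saddleFactor σ' v = S.arcSum v := if_pos hv
    rw [this, mul_left_comm, S.coeffAt_arcSum_mul hv, S.coeffAt_arcSum_mul hv]
  · have h1 : S.saddleFactor σ' v = 1 := if_neg hv
    have h2 : S.saddleFactor τ v = S.arcSum v := if_pos (S.circle_eq_of_flip h hv)
    rw [h1, h2, one_mul]

/-! ### Commutation of the saddles at two vertices -/

section Commute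

variable {v w : V} {σ σ₁ σ₂ σ₁₂ : V → Smoothing}

theorem meets_of_circle_eq (h : Flip v σ σ') {e e' : S.Edge}
    (he : S.circle σ e = S.circle σ e') (hm : S.Meets v (S.circle σ' e')) :
    S.Meets v (S.circle σ' e) := by
  rcases S.circle_eq_or_meets h he with h1 | h1
  · rwa [h1]
  · exact h1.1

theorem meets_swap (hne : S.circle σ (S.lowEdge v) ≠ S.circle σ (S.highEdge v))
    (h1 : S.Meets w (S.circle σ (S.lowEdge v))) (h2 : S.Meets w (S.circle σ (S.highEdge v))) :
    S.Meets v (S.circle σ (S.lowEdge w)) ∧ S.Meets v (S.circle σ (S.highEdge w)) := by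
  rcases h1 with h1 | h1 <;> rcases h2 with h2 | h2
  · exact absurd (h1.trans h2.symm) hne
  · exact ⟨Or.inl h1.symm, Or.inr h2.symm⟩
  · exact ⟨Or.inr h2.symm, Or.inl h1.symm⟩
  · exact absurd (h1.trans h2.symm) hne

/-- The saddle at `w` splits a circle into two circles, which the saddle at `v` merges again. -/
theorem circle_eq_of_split_merge (h₂ : Flip w σ σ₂) (h₁₂ : Flip v σ₂ σ₁₂)
    (hv : S.circle σ (S.lowEdge v) = S.circle σ (S.highEdge v))
    (hv₂ : S.circle σ₂ (S.lowEdge v) ≠ S.circle σ₂ (S.highEdge v)) :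
    S.circle σ₁₂ (S.lowEdge v) = S.circle σ₁₂ (S.highEdge v) ∧
      S.circle σ₁₂ (S.lowEdge w) = S.circle σ₁₂ (S.highEdge w) := by
  have h0 := S.circle_eq_of_flip h₁₂ hv₂
  refine ⟨h0, ?_⟩
  have h1 := (S.circle_eq_or_meets h₂ hv).resolve_left hv₂
  have h2 := S.meets_swap hv₂ h1.1 h1.2
  have h3 : ∀ e, S.Meets v (S.circle σ₂ e) →
      S.circle σ₁₂ e = S.circle σ₁₂ (S.lowEdge v) := by
    rintro e (he | he)
    · exact S.circle_eq_of_coarser h₁₂ h0 he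
    · rw [h0]
      exact S.circle_eq_of_coarser h₁₂ h0 he
  rw [h3 _ h2.1, h3 _ h2.2]

/-- The saddles at `v` and `w` merge the same two circles. -/
theorem rename_arcSum_eq (h₁ : Flip v σ σ₁) (h₂ : Flip w σ σ₂) (h₁₂ : Flip w σ₁ σ₁₂)
    (h₂₁ : Flip v σ₂ σ₁₂)
    (hv : S.circle σ (S.lowEdge v) ≠ S.circle σ (S.highEdge v))
    (hw : S.circle σ (S.lowEdge w) ≠ S.circle σ (S.highEdge w))
    (hv₂ : S.circle σ₂ (S.lowEdge v) = S.circle σ₂ (S.highEdge v)) :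
    S.circle σ₁ (S.lowEdge w) = S.circle σ₁ (S.highEdge w) ∧
      rename (S.circle σ₁₂) (S.arcSum v) = rename (S.circle σ₁₂) (S.arcSum w) := by
  have h1 := (S.circle_eq_or_meets h₂.symm hv₂).resolve_left hv
  have h2 := S.meets_swap hv h1.1 h1.2
  have hv₁ := S.circle_eq_of_flip h₁ hv
  have hw₂ := S.circle_eq_of_flip h₂ hw
  have c₁ : ∀ e, S.Meets v (S.circle σ e) → S.circle σ₁ e = S.circle σ₁ (S.lowEdge v) := by
    rintro e (he | he)
    · exact S.circle_eq_of_coarser h₁ hv₁ he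
    · rw [hv₁]
      exact S.circle_eq_of_coarser h₁ hv₁ he
  have c₂ : ∀ e, S.Meets w (S.circle σ e) → S.circle σ₂ e = S.circle σ₂ (S.lowEdge w) := by
    rintro e (he | he)
    · exact S.circle_eq_of_coarser h₂ hw₂ he
    · rw [hw₂]
      exact S.circle_eq_of_coarser h₂ hw₂ he
  have w1 := c₁ _ h2.1
  have w2 := c₁ _ h2.2
  have v1 := c₂ _ h1.1
  refine ⟨w1.trans w2.symm, ?_⟩
  have m1 : S.Meets w (S.circle σ₁₂ (S.lowEdge v)) :=
    S.meets_of_circle_eq h₁₂ w1.symm (Or.inl rfl)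
  have m2 : S.Meets w (S.circle σ₁₂ (S.highEdge v)) :=
    S.meets_of_circle_eq h₁₂ (hv₁.symm.trans w1.symm) (Or.inl rfl)
  have m3 : S.Meets v (S.circle σ₁₂ (S.lowEdge w)) :=
    S.meets_of_circle_eq h₂₁ v1.symm (Or.inl rfl)
  have m4 : S.Meets v (S.circle σ₁₂ (S.highEdge w)) :=
    S.meets_of_circle_eq h₂₁ (hw₂.symm.trans v1.symm) (Or.inl rfl)
  rw [rename_arcSum, rename_arcSum]
  by_cases hne : S.circle σ₁₂ (S.lowEdge v) = S.circle σ₁₂ (S.highEdge v)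
  · have : S.circle σ₁₂ (S.lowEdge w) = S.circle σ₁₂ (S.highEdge w) := by
      rcases m3 with m3 | m3 <;> rcases m4 with m4 | m4 <;> simp only [m3, m4, hne]
    rw [hne, this, CharTwo.add_self_eq_zero, CharTwo.add_self_eq_zero]
  · rcases m1 with m1 | m1 <;> rcases m2 with m2 | m2
    · exact absurd (m1.trans m2.symm) hne
    · rw [m1, m2]
    · rw [m1, m2, add_comm]
    · exact absurd (m1.trans m2.symm) hne

/-- The cases are whether each saddle merges at `σ`, and whether the other saddle changes this.
Equality is needed only after passing to the circles of `σ₁₂`. -/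
theorem saddleFactor_comm (h₁ : Flip v σ σ₁) (h₂ : Flip w σ σ₂) (h₁₂ : Flip w σ₁ σ₁₂)
    (h₂₁ : Flip v σ₂ σ₁₂) :
    rename (S.circle σ₁₂) (S.saddleFactor σ₁ w * S.saddleFactor σ v) =
      rename (S.circle σ₁₂) (S.saddleFactor σ₂ v * S.saddleFactor σ w) := by
  rw [map_mul, map_mul]
  unfold saddleFactor
  by_cases hv : S.circle σ (S.lowEdge v) = S.circle σ (S.highEdge v) <;>
    by_cases hw : S.circle σ (S.lowEdge w) = S.circle σ (S.highEdge w)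
  · by_cases hv₂ : S.circle σ₂ (S.lowEdge v) = S.circle σ₂ (S.highEdge v)
    · by_cases hw₁ : S.circle σ₁ (S.lowEdge w) = S.circle σ₁ (S.highEdge w)
      · rw [if_pos hv, if_pos hw, if_pos hv₂, if_pos hw₁, mul_comm]
      · obtain ⟨h3, h4⟩ := S.circle_eq_of_split_merge h₁ h₁₂ hw hw₁
        rw [if_pos hv, if_pos hw, S.rename_arcSum_eq_zero h3, S.rename_arcSum_eq_zero h4, mul_zero,
          mul_zero]
    · obtain ⟨h3, h4⟩ := S.circle_eq_of_split_merge h₂ h₂₁ hv hv₂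
      rw [if_pos hv, if_pos hw, S.rename_arcSum_eq_zero h3, S.rename_arcSum_eq_zero h4, mul_zero,
        mul_zero]
  · have hv₂ := S.circle_eq_of_coarser h₂ (S.circle_eq_of_flip h₂ hw) hv
    have hw₁ : S.circle σ₁ (S.lowEdge w) ≠ S.circle σ₁ (S.highEdge w) :=
      fun h => hw (S.circle_eq_of_coarser h₁.symm hv h)
    rw [if_pos hv, if_neg hw, if_pos hv₂, if_neg hw₁, mul_comm]
  · have hw₁ := S.circle_eq_of_coarser h₁ (S.circle_eq_of_flip h₁ hv) hw
    have hv₂ : S.circle σ₂ (S.lowEdge v) ≠ S.circle σ₂ (S.highEdge v) :=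
      fun h => hv (S.circle_eq_of_coarser h₂.symm hw h)
    rw [if_neg hv, if_pos hw, if_neg hv₂, if_pos hw₁, mul_comm]
  · rw [if_neg hv, if_neg hw]
    by_cases hv₂ : S.circle σ₂ (S.lowEdge v) = S.circle σ₂ (S.highEdge v)
    · obtain ⟨hw₁, h3⟩ := S.rename_arcSum_eq h₁ h₂ h₁₂ h₂₁ hv hw hv₂
      rw [if_pos hv₂, if_pos hw₁, h3]
    · have hw₁ : S.circle σ₁ (S.lowEdge w) ≠ S.circle σ₁ (S.highEdge w) :=
        fun h => hv₂ (S.rename_arcSum_eq h₂ h₁ h₂₁ h₁₂ hw hv h).1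
      rw [if_neg hv₂, if_neg hw₁]

theorem coeffAt_saddleFactor_comm (h₁ : Flip v σ σ₁) (h₂ : Flip w σ σ₂) (h₁₂ : Flip w σ₁ σ₁₂)
    (h₂₁ : Flip v σ₂ σ₁₂) (ρ : S.Circles σ₁₂ → Label) (f : MvPolynomial S.Edge (ZMod 2)) :
    S.coeffAt ρ (S.saddleFactor σ₁ w * (S.saddleFactor σ v * f)) =
      S.coeffAt ρ (S.saddleFactor σ₂ v * (S.saddleFactor σ w * f)) := by
  rw [← mul_assoc, ← mul_assoc, coeffAt_apply, coeffAt_apply, map_mul,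
    S.saddleFactor_comm h₁ h₂ h₁₂ h₂₁, ← map_mul]

end Commute

/-! ### A saddle lowers the label degree by one -/

section Degree

theorem labelDegree_eq_sum [Fintype (S.Circles σ)] (ρ : S.Circles σ → Label) :
    S.labelDegree ρ = ∑ c, (ρ c).weight := by
  classical
  unfold labelDegree
  rw [Nat.card_eq_fintype_card, Nat.card_eq_fintype_card, Fintype.card_subtype,
    Fintype.card_subtype, Finset.card_filter, Finset.card_filter]
  push_cast
  rw [← Finset.sum_sub_distrib]
  refine Finset.sum_congr rfl fun c _ => ?_
  rcases ρ c with _ | _ <;> simp [Label.weight]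

theorem labelDegree_of_saddleCoeff_ne_zero {v : V} (h : Flip v σ σ') {ρ : S.Circles σ → Label}
    {ρ' : S.Circles σ' → Label} (hne : S.saddleCoeff v ρ ρ' ≠ 0) :
    S.labelDegree ρ' = S.labelDegree ρ - 1 := by
  have := Fintype.ofFinite (S.Circles σ)
  have := Fintype.ofFinite (S.Circles σ')
  rw [labelDegree_eq_sum, labelDegree_eq_sum]
  by_cases hv : S.circle σ (S.lowEdge v) = S.circle σ (S.highEdge v)
  · by_cases hv' : S.circle σ' (S.lowEdge v) = S.circle σ' (S.highEdge v)
    · exact absurd (S.saddleCoeff_of_single hv hv' ρ ρ') hne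
    · obtain ⟨g, hg, hm⟩ := S.exists_isMerge h.symm hv'
      rw [S.saddleCoeff_of_split hg hm] at hne
      exact hm.weight_of_comulMatrix_ne_zero hne
  · obtain ⟨g, hg, hm⟩ := S.exists_isMerge h hv
    rw [S.saddleCoeff_of_merge hg hm] at hne
    exact hm.weight_of_mulMatrix_ne_zero hne

end Degree

/-- With one edge chosen on each circle, the monomial of `ρ` lifts to the edge variables. Hence
identities checked on polynomials hold on every basis vector. -/
theorem exists_coeffAt_eq [DecidableEq (S.Circles σ → Label)] (ρ : S.Circles σ → Label) :
    ∃ f, ∀ ρ' : S.Circles σ → Label, S.coeffAt ρ' f = if ρ' = ρ then 1 else 0 := by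
  classical
  obtain ⟨k, hk⟩ := (S.circle_surjective σ).hasRightInverse
  refine ⟨monomial ((labelExponent ρ).mapDomain k) 1, fun ρ' => ?_⟩
  have : (S.circle σ) ∘ k = id := funext hk
  rw [coeffAt_apply, rename_monomial, ← Finsupp.mapDomain_comp, this, Finsupp.mapDomain_id,
    labelCoeff_apply, coeff_monomial]
  refine if_congr ⟨fun h => funext fun c => ?_, fun h => h ▸ rfl⟩ rfl rfl
  have := DFunLike.congr_fun h c
  rw [labelExponent_apply, labelExponent_apply] at this
  rcases h1 : ρ c with _ | _ <;> rcases h2 : ρ' c with _ | _ <;> simp_all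

end Shadow

/-! ## The multiple mapping cone is a complex -/

theorem sum_sum_eq_zero_of_symm {ι : Type*} [Fintype ι] (G : ι → ι → ZMod 2)
    (hG : ∀ i j, G i j = G j i) (h0 : ∀ i, G i i = 0) : ∑ i, ∑ j, G i j = 0 := by
  rw [← Fintype.sum_prod_type']
  refine Finset.sum_involution (fun p _ => p.swap) ?_ ?_ (fun _ _ => Finset.mem_univ _)
    (fun _ _ => Prod.swap_swap _)
  · rintro ⟨i, j⟩ _
    change G i j + G j i = 0
    rw [hG i j]
    exact CharTwo.add_self_eq_zero _
  · rintro ⟨i, j⟩ _ hne heq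
    obtain rfl : j = i := congrArg Prod.fst heq
    exact hne (h0 j)

section Smoothings

variable {V : Type*} [DecidableEq V]

theorem flip_stateSmoothing [Fintype V] (ε : V → CrossingSign) {s : Finset V} {c : V} (hc : c ∉ s) :
    Shadow.Flip c (stateSmoothing ε s) (stateSmoothing ε (insert c s)) := by
  constructor
  · unfold stateSmoothing
    cases ε c <;> simp [CrossingSign.smoothing, hc]
  · intro w hw
    simp [stateSmoothing, hw]

end Smoothings

namespace SingularLinkDiagram

open MvPolynomial

variable {V : Type*} [Fintype V] [DecidableEq V] (D : SingularLinkDiagram V)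

omit [DecidableEq V] in
theorem mem_doublePoints {b : V} : b ∈ D.doublePoints ↔ D.kind b = .double := by
  simp [doublePoints]

theorem signOf_of_mem {b : V} (hb : b ∈ D.doublePoints) (A : Finset V) :
    D.signOf A b = if b ∈ A then .pos else .neg := by
  rw [mem_doublePoints] at hb
  simp [signOf, hb]

theorem signOf_insert_of_ne {b v : V} (h : v ≠ b) (A : Finset V) :
    D.signOf (insert b A) v = D.signOf A v := by
  simp [signOf, h]

/-- The smoothings of the diagram `D_A` given by a state. -/
abbrev smoothingOf (A s : Finset V) : V → Smoothing :=
  stateSmoothing (D.signOf A) s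

theorem smoothingOf_eq_vert {A s : Finset V} {b : V} (hb : b ∈ D.doublePoints) (hA : b ∉ A)
    (hs : b ∈ s) : D.smoothingOf A s b = .vert := by
  simp [smoothingOf, stateSmoothing, D.signOf_of_mem hb, hA, hs, CrossingSign.smoothing]

/-- The vertical smoothing is the `1`-smoothing of a negative and the `0`-smoothing of a positive
crossing. The genus-one map is thus an endomorphism of one tensor power. -/
theorem smoothingOf_insert_erase {A s : Finset V} {b : V} (hb : b ∈ D.doublePoints) (hA : b ∉ A)
    (hs : b ∈ s) : D.smoothingOf (insert b A) (s.erase b) = D.smoothingOf A s := by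
  funext v
  by_cases hv : v = b
  · subst hv
    rw [D.smoothingOf_eq_vert hb hA hs]
    simp [smoothingOf, stateSmoothing, D.signOf_of_mem hb, CrossingSign.smoothing]
  · simp [smoothingOf, stateSmoothing, D.signOf_insert_of_ne hv, hv]

theorem flip_update_horiz {A s : Finset V} {b : V} (hb : b ∈ D.doublePoints) (hA : b ∉ A)
    (hs : b ∈ s) :
    Shadow.Flip b (D.smoothingOf A s) (Function.update (D.smoothingOf A s) b .horiz) := by
  constructor
  · rw [D.smoothingOf_eq_vert hb hA hs]
    simp
  · intro w hw
    simp [hw]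

/-- The chain of `C(D_A)` represented by a polynomial in the edges at the state `s`. -/
noncomputable def vec (A s : Finset V) (f : MvPolynomial D.shadow.Edge (ZMod 2)) :
    D.Generator → ZMod 2 :=
  fun a => if a.1.1 = A ∧ a.2.1 = s then D.shadow.coeffAt a.2.2 f else 0

theorem vec_congr {A s : Finset V} {f f' : MvPolynomial D.shadow.Edge (ZMod 2)}
    (h : ∀ ρ : D.shadow.Circles (D.smoothingOf A s) → Label,
      D.shadow.coeffAt ρ f = D.shadow.coeffAt ρ f') : D.vec A s f = D.vec A s f' := by
  funext ⟨⟨A', hA'⟩, ⟨s', ρ⟩⟩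
  unfold vec
  split_ifs with h1
  · obtain ⟨h1, h2⟩ := h1
    dsimp only at h1 h2
    subst h1 h2
    exact h ρ
  · rfl

theorem vec_eq_zero {A s : Finset V} {f : MvPolynomial D.shadow.Edge (ZMod 2)}
    (h : ∀ ρ : D.shadow.Circles (D.smoothingOf A s) → Label, D.shadow.coeffAt ρ f = 0) :
    D.vec A s f = 0 := by
  rw [D.vec_congr (f' := 0) (fun ρ => by rw [h, map_zero])]
  funext a
  simp [vec]

noncomputable instance fintypeGenerator : Fintype D.Generator := Fintype.ofFinite _

theorem exists_vec_eq [DecidableEq D.Generator] (a : D.Generator) :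
    ∃ f, ∀ a', D.vec a.1.1 a.2.1 f a' = if a' = a then 1 else 0 := by
  classical
  obtain ⟨⟨A, hA⟩, ⟨s, ρ⟩⟩ := a
  obtain ⟨f, hf⟩ := D.shadow.exists_coeffAt_eq ρ
  refine ⟨f, ?_⟩
  rintro ⟨⟨A', hA'⟩, ⟨s', ρ'⟩⟩
  unfold vec
  dsimp only
  by_cases h1 : A' = A ∧ s' = s
  · rw [if_pos h1]
    obtain ⟨rfl, rfl⟩ := h1
    rw [hf]
    refine if_congr ⟨fun h => by rw [h], fun h => ?_⟩ rfl rfl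
    simpa using h
  · rw [if_neg h1, if_neg]
    intro h2
    refine h1 ?_
    cases h2
    exact ⟨rfl, rfl⟩

theorem sum_vec_mul {A s : Finset V} (hA : A ⊆ D.doublePoints)
    [Fintype (D.shadow.Circles (D.smoothingOf A s) → Label)]
    (f : MvPolynomial D.shadow.Edge (ZMod 2)) (K : D.Generator → ZMod 2) :
    ∑ a, D.vec A s f a * K a =
      ∑ ρ : D.shadow.Circles (D.smoothingOf A s) → Label,
        D.shadow.coeffAt ρ f * K ⟨⟨A, hA⟩, ⟨s, ρ⟩⟩ := by
  symm
  refine Fintype.sum_of_injective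
    (fun ρ : D.shadow.Circles (D.smoothingOf A s) → Label => (⟨⟨A, hA⟩, ⟨s, ρ⟩⟩ : D.Generator))
    ?_ _ _ ?_ ?_
  · intro ρ ρ' h
    simpa using h
  · rintro ⟨⟨A', hA'⟩, ⟨s', ρ'⟩⟩ hn
    unfold vec
    rw [if_neg, zero_mul]
    rintro ⟨h1, h2⟩
    dsimp only at h1 h2
    subst h1 h2
    exact hn ⟨ρ', rfl⟩
  · intro ρ
    simp [vec]

theorem sum_vec_mul_diffCoeff {A s : Finset V}
    [Fintype (D.shadow.Circles (D.smoothingOf A s) → Label)]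
    (f : MvPolynomial D.shadow.Edge (ZMod 2)) (a' : D.Generator) :
    ∑ ρ : D.shadow.Circles (D.smoothingOf A s) → Label, D.shadow.coeffAt ρ f *
        (if a'.1.1 = A then
          D.shadow.diffCoeff (⟨s, ρ⟩ : D.shadow.EnhancedState (D.signOf A)) a'.2 else 0) =
      ∑ c, if c ∉ s then
        D.vec A (insert c s) (D.shadow.saddleFactor (D.smoothingOf A s) c * f) a' else 0 := by
  obtain ⟨⟨A', hA'⟩, ⟨s', ρ'⟩⟩ := a'
  unfold vec Shadow.diffCoeff
  dsimp only
  by_cases hA : A' = A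
  · subst hA
    simp only [if_true, true_and, Finset.mul_sum]
    rw [Finset.sum_comm]
    refine Finset.sum_congr rfl fun c _ => ?_
    by_cases hc : c ∈ s
    · simp [hc]
    · by_cases hs : s' = insert c s
      · subst hs
        simp only [hc, not_false_eq_true, true_and, if_true]
        exact D.shadow.sum_saddleCoeff (flip_stateSmoothing _ hc) ρ' f
      · simp [hs]
  · simp [hA]

theorem sum_vec_mul_genusOneCoeff {A s : Finset V}
    [Fintype (D.shadow.Circles (D.smoothingOf A s) → Label)]
    (f : MvPolynomial D.shadow.Edge (ZMod 2)) (a' : D.Generator) {b : V}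
    (hb : b ∈ D.doublePoints) :
    ∑ ρ : D.shadow.Circles (D.smoothingOf A s) → Label, D.shadow.coeffAt ρ f *
        (if b ∉ A ∧ a'.1.1 = insert b A then D.shadow.genusOneCoeff b
          (⟨s, ρ⟩ : D.shadow.EnhancedState (D.signOf A)) a'.2 else 0) =
      if b ∉ A ∧ b ∈ s then
        D.vec (insert b A) (s.erase b) (D.shadow.arcSum b * f) a' else 0 := by
  obtain ⟨⟨A', hA'⟩, ⟨s', ρ'⟩⟩ := a'
  unfold vec Shadow.genusOneCoeff
  dsimp only
  by_cases hbA : b ∈ A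
  · simp [hbA]
  by_cases hbs : b ∈ s
  · by_cases hA : A' = insert b A
    · subst hA
      by_cases hs : s' = s.erase b
      · subst hs
        simp only [hbA, hbs, not_false_eq_true, and_self, if_true]
        have := Fintype.ofFinite (D.shadow.Circles
          (Function.update (stateSmoothing (D.signOf A) s) b .horiz) → Label)
        simp only [finsum_eq_sum_of_fintype]
        exact D.shadow.sum_saddleCoeff_mul_saddleCoeff (D.flip_update_horiz hb hbA hbs)
          (D.smoothingOf_insert_erase hb hbA hbs) ρ' f
      · simp [hs]
    · simp [hA]
  · simp [hbs]

/-- The components of the differential: `inl c` is the saddle at the crossing `c`, `inr b` is the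
genus-one map at the double point `b`. This says whether the component starts at `(A, s)`. -/
def MoveAllowed (A s : Finset V) : V ⊕ V → Prop
  | .inl c => c ∉ s
  | .inr b => b ∈ D.doublePoints ∧ b ∉ A ∧ b ∈ s

instance (A s : Finset V) : DecidablePred (D.MoveAllowed A s)
  | .inl c => inferInstanceAs (Decidable (c ∉ s))
  | .inr b => inferInstanceAs (Decidable (b ∈ D.doublePoints ∧ b ∉ A ∧ b ∈ s))

/-- The image of `vec A s f` under a component of the differential. -/
noncomputable def moveVec (A s : Finset V) (f : MvPolynomial D.shadow.Edge (ZMod 2)) :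
    V ⊕ V → D.Generator → ZMod 2
  | .inl c => D.vec A (insert c s) (D.shadow.saddleFactor (D.smoothingOf A s) c * f)
  | .inr b => D.vec (insert b A) (s.erase b) (D.shadow.arcSum b * f)

theorem sum_vec_mul_coneCoeff {A s : Finset V} (hA : A ⊆ D.doublePoints)
    (f : MvPolynomial D.shadow.Edge (ZMod 2)) (a' : D.Generator) :
    ∑ a, D.vec A s f a * D.coneCoeff a a' =
      ∑ m, if D.MoveAllowed A s m then D.moveVec A s f m a' else 0 := by
  have := Fintype.ofFinite (D.shadow.Circles (D.smoothingOf A s) → Label)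
  rw [D.sum_vec_mul hA, Fintype.sum_sum_type]
  unfold coneCoeff
  dsimp only [MoveAllowed, moveVec]
  simp only [mul_add, Finset.sum_add_distrib]
  congr 1
  · exact D.sum_vec_mul_diffCoeff f a'
  · simp only [Finset.mul_sum]
    rw [Finset.sum_comm, Finset.sum_congr rfl
      (fun b hb => D.sum_vec_mul_genusOneCoeff (A := A) (s := s) f a' hb)]
    refine Finset.sum_subset_zero_on_sdiff (Finset.subset_univ _) (fun b hb => ?_) fun b hb => ?_
    · have hb' : b ∉ D.doublePoints := by simpa using hb
      exact if_neg fun h : D.MoveAllowed A s (.inr b) => hb' h.1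
    · by_cases h : b ∉ A ∧ b ∈ s
      · rw [if_pos h]
        exact (if_pos (show D.MoveAllowed A s (.inr b) from ⟨hb, h⟩)).symm
      · rw [if_neg h]
        exact (if_neg fun h' : D.MoveAllowed A s (.inr b) => h h'.2).symm

/-- The composite of two components of the differential. -/
noncomputable def moveMoveVec (A s : Finset V) (f : MvPolynomial D.shadow.Edge (ZMod 2)) :
    V ⊕ V → V ⊕ V → D.Generator → ZMod 2
  | .inl c, m => if D.MoveAllowed A (insert c s) m then
      D.moveVec A (insert c s) (D.shadow.saddleFactor (D.smoothingOf A s) c * f) m else 0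
  | .inr b, m => if D.MoveAllowed (insert b A) (s.erase b) m then
      D.moveVec (insert b A) (s.erase b) (D.shadow.arcSum b * f) m else 0

theorem sum_moveVec_mul_coneCoeff {A s : Finset V} (hA : A ⊆ D.doublePoints)
    (f : MvPolynomial D.shadow.Edge (ZMod 2)) {m : V ⊕ V} (hm : D.MoveAllowed A s m)
    (a' : D.Generator) :
    ∑ a, D.moveVec A s f m a * D.coneCoeff a a' = ∑ m', D.moveMoveVec A s f m m' a' := by
  rcases m with c | b
  · refine (D.sum_vec_mul_coneCoeff hA _ a').trans (Finset.sum_congr rfl fun m' _ => ?_)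
    unfold moveMoveVec
    dsimp only
    split_ifs <;> rfl
  · refine (D.sum_vec_mul_coneCoeff (Finset.insert_subset hm.1 hA) _ a').trans
      (Finset.sum_congr rfl fun m' _ => ?_)
    unfold moveMoveVec
    dsimp only
    split_ifs <;> rfl

theorem moveMoveVec_self {A s : Finset V} (f : MvPolynomial D.shadow.Edge (ZMod 2))
    (m : V ⊕ V) : D.moveMoveVec A s f m m = 0 := by
  rcases m with c | b <;> simp [moveMoveVec, MoveAllowed]

theorem moveMoveVec_inl_inl {A s : Finset V} (f : MvPolynomial D.shadow.Edge (ZMod 2)) {c c' : V}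
    (hc : c ∉ s) (hc' : c' ∉ s) :
    D.moveMoveVec A s f (.inl c) (.inl c') = D.moveMoveVec A s f (.inl c') (.inl c) := by
  by_cases hne : c = c'
  · rw [hne]
  have h1 : c' ∉ insert c s := by simp [Ne.symm hne, hc']
  have h2 : c ∉ insert c' s := by simp [hne, hc]
  simp only [moveMoveVec, MoveAllowed, h1, h2, not_false_eq_true, if_true, moveVec]
  rw [Finset.insert_comm c c' s]
  refine D.vec_congr fun ρ => ?_
  refine D.shadow.coeffAt_saddleFactor_comm (flip_stateSmoothing _ hc) (flip_stateSmoothing _ hc')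
    (flip_stateSmoothing _ h1) ?_ ρ f
  rw [Finset.insert_comm c' c s]
  exact flip_stateSmoothing _ h2

/-- The genus-one map is a chain map. For `c ≠ b` the smoothing, and with it the saddle factor at
`c`, is not affected by the move at `b`. For `c = b` the two composites start at different states,
and each vanishes by itself. -/
theorem moveMoveVec_inl_inr {A s : Finset V} (f : MvPolynomial D.shadow.Edge (ZMod 2)) {c b : V} :
    (if c ∉ s then D.moveMoveVec A s f (.inl c) (.inr b) else 0) =
      if b ∈ D.doublePoints ∧ b ∉ A ∧ b ∈ s then D.moveMoveVec A s f (.inr b) (.inl c) else 0 := by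
  by_cases hb : b ∈ D.doublePoints
  swap
  · simp [hb, moveMoveVec, MoveAllowed]
  by_cases hA : b ∈ A
  · simp [hA, moveMoveVec, MoveAllowed]
  by_cases hne : c = b
  · subst hne
    have h1 : c ∉ s → D.vec (insert c A) ((insert c s).erase c) (D.shadow.arcSum c *
        (D.shadow.saddleFactor (D.smoothingOf A s) c * f)) = 0 := fun hs => by
      refine D.vec_eq_zero fun ρ => ?_
      rw [mul_left_comm]
      refine D.shadow.coeffAt_saddleFactor_arcSum (σ := D.smoothingOf A s) ?_ ρ f
      rw [D.smoothingOf_insert_erase hb hA (Finset.mem_insert_self c s)]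
      exact flip_stateSmoothing _ hs
    have h2 : D.vec (insert c A) (insert c (s.erase c))
        (D.shadow.saddleFactor (D.smoothingOf (insert c A) (s.erase c)) c *
          (D.shadow.arcSum c * f)) = 0 := by
      refine D.vec_eq_zero fun ρ => ?_
      exact D.shadow.coeffAt_saddleFactor_arcSum (flip_stateSmoothing _ (Finset.notMem_erase c s))
        ρ f
    simp only [moveMoveVec, moveVec, h2, ite_self]
    by_cases hs : c ∈ s
    · rw [if_neg (not_not.2 hs)]
    · rw [if_pos hs, h1 hs, ite_self]
  · by_cases hs : b ∈ s
    · by_cases hc : c ∈ s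
      · simp [hc, moveMoveVec, MoveAllowed, hne]
      · simp only [moveMoveVec, moveVec, MoveAllowed, hc, hs, hA, hb, not_false_eq_true,
          and_self, if_true, Finset.mem_insert, or_true, Finset.mem_erase, and_false]
        rw [Finset.erase_insert_of_ne hne, D.smoothingOf_insert_erase hb hA hs, mul_left_comm]
    · simp [hs, moveMoveVec, MoveAllowed, Ne.symm hne]

theorem moveMoveVec_inr_inr {A s : Finset V} (f : MvPolynomial D.shadow.Edge (ZMod 2)) {b b' : V}
    (hb : D.MoveAllowed A s (.inr b)) (hb' : D.MoveAllowed A s (.inr b')) :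
    D.moveMoveVec A s f (.inr b) (.inr b') = D.moveMoveVec A s f (.inr b') (.inr b) := by
  by_cases hne : b = b'
  · rw [hne]
  obtain ⟨h1, h2, h3⟩ := hb
  obtain ⟨h1', h2', h3'⟩ := hb'
  simp only [moveMoveVec, moveVec, MoveAllowed, h1, h2, h3, h1', h2', h3', hne, Ne.symm hne,
    Finset.mem_insert, Finset.mem_erase, or_self, not_false_eq_true, and_self, if_true, ne_eq]
  rw [Finset.insert_comm, Finset.erase_right_comm, mul_left_comm]

/-- The guards make this hold for all pairs: if only one order can be started, its second move is
still forbidden. The exception is a saddle and a genus-one map at the same vertex, where one move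
enables the other but the composite is zero. -/
theorem moveMoveVec_symm (A s : Finset V) (f : MvPolynomial D.shadow.Edge (ZMod 2))
    (m m' : V ⊕ V) : (if D.MoveAllowed A s m then D.moveMoveVec A s f m m' else 0) =
      if D.MoveAllowed A s m' then D.moveMoveVec A s f m' m else 0 := by
  rcases m with c | b <;> rcases m' with c' | b'
  · by_cases hc : c ∈ s <;> by_cases hc' : c' ∈ s
    · simp [MoveAllowed, hc, hc']
    · simp [MoveAllowed, hc, hc', moveMoveVec]
    · simp [MoveAllowed, hc, hc', moveMoveVec]
    · simp [MoveAllowed, hc, hc', D.moveMoveVec_inl_inl f hc hc']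
  · exact D.moveMoveVec_inl_inr f
  · exact (D.moveMoveVec_inl_inr f).symm
  · by_cases hb : D.MoveAllowed A s (.inr b) <;> by_cases hb' : D.MoveAllowed A s (.inr b')
    · rw [if_pos hb, if_pos hb', D.moveMoveVec_inr_inr f hb hb']
    · rw [if_pos hb, if_neg hb']
      refine if_neg fun h => hb' ⟨h.1, fun h' => h.2.1 (Finset.mem_insert_of_mem h'),
        Finset.mem_of_mem_erase h.2.2⟩
    · rw [if_neg hb, if_pos hb']
      refine (if_neg fun h => hb ⟨h.1, fun h' => h.2.1 (Finset.mem_insert_of_mem h'),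
        Finset.mem_of_mem_erase h.2.2⟩).symm
    · rw [if_neg hb, if_neg hb']

/-- Represent `a` by a polynomial and expand the square over ordered pairs of moves: the summand is
symmetric and zero on the diagonal, so it cancels modulo 2. -/
theorem sum_coneCoeff_mul_coneCoeff (a a'' : D.Generator) :
    ∑ a', D.coneCoeff a a' * D.coneCoeff a' a'' = 0 := by
  classical
  obtain ⟨f, hf⟩ := D.exists_vec_eq a
  have h1 : ∀ a', D.coneCoeff a a' = ∑ m, if D.MoveAllowed a.1.1 a.2.1 m then
      D.moveVec a.1.1 a.2.1 f m a' else 0 := by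
    intro a'
    rw [← D.sum_vec_mul_coneCoeff a.1.2 f a']
    simp [hf]
  simp only [h1, Finset.sum_mul]
  rw [Finset.sum_comm]
  have h2 : ∀ m, ∑ a', (if D.MoveAllowed a.1.1 a.2.1 m then
      D.moveVec a.1.1 a.2.1 f m a' else 0) * D.coneCoeff a' a'' =
      ∑ m', (if D.MoveAllowed a.1.1 a.2.1 m then D.moveMoveVec a.1.1 a.2.1 f m m' else 0) a'' := by
    intro m
    by_cases hm : D.MoveAllowed a.1.1 a.2.1 m
    · simp only [if_pos hm]
      exact D.sum_moveVec_mul_coneCoeff a.1.2 f hm a''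
    · simp [if_neg hm]
  simp only [h2]
  refine sum_sum_eq_zero_of_symm _ (fun m m' => ?_) (fun m => ?_)
  · rw [D.moveMoveVec_symm]
  · rw [D.moveMoveVec_self, ite_self]
    rfl

end SingularLinkDiagram

/-! ## The bidegree of the differential -/

namespace SingularLinkDiagram

variable {V : Type*} [Fintype V] [DecidableEq V] (D : SingularLinkDiagram V)

theorem numSign_neg_insert {A : Finset V} {b : V} (hb : b ∈ D.doublePoints) (hA : b ∉ A) :
    numSign (D.signOf A) .neg = numSign (D.signOf (insert b A)) .neg + 1 := by
  unfold numSign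
  have : (Finset.univ.filter fun v => D.signOf (insert b A) v = .neg) =
      (Finset.univ.filter fun v => D.signOf A v = .neg).erase b := by
    ext v
    by_cases hv : v = b
    · subst hv
      simp [D.signOf_of_mem hb]
    · simp [D.signOf_insert_of_ne hv, hv]
  rw [this, Finset.card_erase_add_one]
  simp [D.signOf_of_mem hb, hA]

theorem numSign_pos_insert {A : Finset V} {b : V} (hb : b ∈ D.doublePoints) (hA : b ∉ A) :
    numSign (D.signOf (insert b A)) .pos = numSign (D.signOf A) .pos + 1 := by
  unfold numSign
  have : (Finset.univ.filter fun v => D.signOf A v = .pos) =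
      (Finset.univ.filter fun v => D.signOf (insert b A) v = .pos).erase b := by
    ext v
    by_cases hv : v = b
    · subst hv
      simp [D.signOf_of_mem hb, hA]
    · simp [D.signOf_insert_of_ne hv, hv]
  rw [this, Finset.card_erase_add_one]
  simp [D.signOf_of_mem hb]

theorem exists_of_coneCoeff_ne_zero {A A' : Finset V} {hA : A ⊆ D.doublePoints}
    {hA' : A' ⊆ D.doublePoints} {a : D.shadow.EnhancedState (D.signOf A)}
    {a' : D.shadow.EnhancedState (D.signOf A')}
    (h : D.coneCoeff ⟨⟨A, hA⟩, a⟩ ⟨⟨A', hA'⟩, a'⟩ ≠ 0) :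
    (A' = A ∧ D.shadow.diffCoeff a a' ≠ 0) ∨
      ∃ b ∈ D.doublePoints, b ∉ A ∧ A' = insert b A ∧ D.shadow.genusOneCoeff b a a' ≠ 0 := by
  by_contra! hn
  refine h ?_
  unfold coneCoeff
  dsimp only
  rw [Finset.sum_eq_zero, add_zero]
  · split_ifs with h1
    exacts [hn.1 h1, rfl]
  · intro b hb
    split_ifs with h1
    exacts [hn.2 b hb h1.1 h1.2, rfl]

theorem degree_of_coneCoeff_ne_zero {a a' : D.Generator} (h : D.coneCoeff a a' ≠ 0) :
    D.homDegree a' = D.homDegree a + 1 ∧ D.quantumDegree a' = D.quantumDegree a := by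
  obtain ⟨⟨A, hA⟩, ⟨s, ρ⟩⟩ := a
  obtain ⟨⟨A', hA'⟩, ⟨s', ρ'⟩⟩ := a'
  unfold homDegree quantumDegree Shadow.homDegree Shadow.quantumDegree
  dsimp only
  rcases D.exists_of_coneCoeff_ne_zero h with ⟨rfl, h1⟩ | ⟨b, hb, hbA, rfl, h1⟩
  · obtain ⟨c, -, hc⟩ := Finset.exists_ne_zero_of_sum_ne_zero h1
    simp only [ne_eq, ite_eq_right_iff, not_forall] at hc
    obtain ⟨⟨hcs, rfl⟩, hc⟩ := hc
    rw [D.shadow.labelDegree_of_saddleCoeff_ne_zero (flip_stateSmoothing _ hcs) hc,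
      Finset.card_insert_of_notMem hcs]
    push_cast
    constructor <;> ring
  · unfold Shadow.genusOneCoeff at h1
    simp only [ne_eq, ite_eq_right_iff, not_forall] at h1
    obtain ⟨⟨hbs, rfl⟩, h1⟩ := h1
    obtain ⟨τ, hτ⟩ : ∃ τ : D.shadow.Circles
        (Function.update (stateSmoothing (D.signOf A) s) b .horiz) → Label,
        D.shadow.saddleCoeff b ρ τ * D.shadow.saddleCoeff b τ ρ' ≠ 0 := by
      by_contra! h2
      exact h1 (finsum_eq_zero_of_forall_eq_zero h2)
    have hf := D.flip_update_horiz hb hbA hbs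
    have hf' : Shadow.Flip b (Function.update (D.smoothingOf A s) b .horiz)
        (D.smoothingOf (insert b A) (s.erase b)) := by
      rw [D.smoothingOf_insert_erase hb hbA hbs]
      exact hf.symm
    have e1 := D.shadow.labelDegree_of_saddleCoeff_ne_zero hf (left_ne_zero_of_mul hτ)
    have e2 := D.shadow.labelDegree_of_saddleCoeff_ne_zero hf' (right_ne_zero_of_mul hτ)
    have e3 := D.numSign_neg_insert hb hbA
    have e4 := D.numSign_pos_insert hb hbA
    have e5 := Finset.card_insert_of_notMem hbA
    have e6 := Finset.card_erase_add_one hbs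
    -- The two saddles lower the label degree by 2 and `|s|` drops by 1, while `n_+` rises and `n_-`
    -- falls by 1: in total `-2 - 1 + 1 + 2 = 0`. In the homological degree `|s| - n_-` is unchanged
    -- and the shift contributes 1.
    rw [e2, e1, e3, e4, e5, ← e6]
    push_cast
    constructor <;> ring

theorem diff_comp_diff (i j : ℤ) : D.diff i (i + 1) j ∘ₗ D.diff (i - 1) i j = 0 := by
  classical
  unfold diff
  rw [← Matrix.mulVecLin_mul]
  refine Eq.trans (congrArg Matrix.mulVecLin ?_) Matrix.mulVecLin_zero
  ext a'' a
  rw [Matrix.mul_apply, Matrix.zero_apply, ← D.sum_coneCoeff_mul_coneCoeff a.1 a''.1]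
  simp only [Matrix.of_apply]
  refine Fintype.sum_of_injective (fun a' : D.GeneratorOf i j => a'.1) Subtype.val_injective _ _
    ?_ ?_
  -- The full sum over generators may be restricted to bidegree `(i, j)`, since the differential has
  -- bidegree `(1, 0)`.
  · intro a' ha'
    by_contra hne
    obtain ⟨h1, h2⟩ := D.degree_of_coneCoeff_ne_zero (left_ne_zero_of_mul hne)
    refine ha' ⟨⟨a', ?_, ?_⟩, rfl⟩
    · rw [h1, a.2.1, sub_add_cancel]
    · rw [h2, a.2.2]
  · intro a'
    exact mul_comm _ _

end SingularLinkDiagram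

/-! ## The Euler characteristic -/

theorem Submodule.finrank_quotient_submoduleOf_add {K M : Type*} [Field K] [AddCommGroup M]
    [Module K M] [Module.Finite K M] {p q : Submodule K M} (h : p ≤ q) :
    Module.finrank K (q ⧸ p.submoduleOf q) + Module.finrank K p = Module.finrank K q := by
  rw [← (Submodule.submoduleOfEquivOfLe h).finrank_eq]
  exact Submodule.finrank_quotient_add_finrank _

theorem LaurentPolynomial.T_sum {ι : Type*} (s : Finset ι) (f : ι → ℤ) :
    (LaurentPolynomial.T (∑ i ∈ s, f i) : ℤ[T;T⁻¹]) = ∏ i ∈ s, LaurentPolynomial.T (f i) := by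
  classical
  induction s using Finset.induction_on with
  | empty => simp
  | insert a s ha ih => rw [Finset.sum_insert ha, Finset.prod_insert ha, LaurentPolynomial.T_add, ih]

theorem Shadow.sum_T_labelDegree {V : Type*} [Fintype V] (S : Shadow V) (σ : V → Smoothing)
    [Fintype (S.Circles σ → Label)] :
    ∑ ρ : S.Circles σ → Label, (LaurentPolynomial.T (S.labelDegree ρ) : ℤ[T;T⁻¹]) =
      (LaurentPolynomial.T 1 + LaurentPolynomial.T (-1)) ^ Nat.card (S.Circles σ) := by
  classical
  have := Fintype.ofFinite (S.Circles σ)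
  have h := Finset.prod_univ_sum (fun _ : S.Circles σ => (Finset.univ : Finset Label))
    (fun _ l => (LaurentPolynomial.T l.weight : ℤ[T;T⁻¹]))
  have h1 : ∑ l : Label, (LaurentPolynomial.T l.weight : ℤ[T;T⁻¹]) =
      LaurentPolynomial.T 1 + LaurentPolynomial.T (-1) := by
    rw [show (Finset.univ : Finset Label) = {.one, .x} from rfl, Finset.sum_pair (by simp)]
    rfl
  rw [h1, Finset.prod_const, Finset.card_univ, ← Nat.card_eq_fintype_card] at h
  rw [h, Fintype.piFinset_univ]
  refine Finset.sum_congr (by ext; simp) fun ρ _ => ?_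
  rw [labelDegree_eq_sum, LaurentPolynomial.T_sum]

namespace SingularLinkDiagram

open LaurentPolynomial

variable {V : Type*} [Fintype V] [DecidableEq V] (D : SingularLinkDiagram V)

theorem range_diff_le_ker_diff (i j : ℤ) :
    LinearMap.range (D.diff (i - 1) i j) ≤ LinearMap.ker (D.diff i (i + 1) j) :=
  LinearMap.range_le_ker_iff.2 (D.diff_comp_diff i j)

/-- The rank of the differential. -/
noncomputable def diffRank (i i' j : ℤ) : ℕ :=
  Module.finrank (ZMod 2) (LinearMap.range (D.diff i i' j))

theorem finrank_Kh (i j : ℤ) : (Module.finrank (ZMod 2) (D.Kh i j) : ℤ) =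
    Fintype.card (D.GeneratorOf i j) - D.diffRank i (i + 1) j - D.diffRank (i - 1) i j := by
  have h1 := Submodule.finrank_quotient_submoduleOf_add (D.range_diff_le_ker_diff i j)
  have h2 := LinearMap.finrank_range_add_finrank_ker (D.diff i (i + 1) j)
  rw [Module.finrank_fintype_fun_eq_card] at h2
  unfold diffRank
  change Module.finrank (ZMod 2) (D.Kh i j) + _ = _ at h1
  omega

theorem diffRank_le (i i' j : ℤ) : D.diffRank i i' j ≤ Fintype.card (D.GeneratorOf i j) := by
  have h2 := LinearMap.finrank_range_add_finrank_ker (D.diff i i' j)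
  rw [Module.finrank_fintype_fun_eq_card] at h2
  unfold diffRank
  omega

/-- The bidegree of a generator. -/
noncomputable def bidegree (a : D.Generator) : ℤ × ℤ :=
  (D.homDegree a, D.quantumDegree a)

/-- The monomial `(-1)^i q^j`. -/
noncomputable def signedMonomial (p : ℤ × ℤ) : ℤ[T;T⁻¹] :=
  C (Int.negOnePow p.1 : ℤ) * T p.2

theorem signedMonomial_sub_one (i j : ℤ) : signedMonomial (i - 1, j) = -signedMonomial (i, j) := by
  unfold signedMonomial
  rw [Int.negOnePow_sub, Int.negOnePow_one]
  simp only [mul_neg, mul_one, Units.val_neg, map_neg, neg_mul]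

theorem hasFiniteSupport_of_le_card (u : ℤ × ℤ → ℕ)
    (hu : ∀ p, u p ≤ Fintype.card (D.GeneratorOf p.1 p.2)) :
    (fun p => signedMonomial p * C (u p : ℤ)).HasFiniteSupport := by
  refine (Set.finite_range D.bidegree).subset fun p hp => ?_
  have h1 : Fintype.card (D.GeneratorOf p.1 p.2) ≠ 0 := by
    intro h0
    have := hu p
    rw [h0, Nat.le_zero] at this
    simp [this] at hp
  obtain ⟨a⟩ := Fintype.card_pos_iff.1 (Nat.pos_of_ne_zero h1)
  exact ⟨a.1, Prod.ext a.2.1 a.2.2⟩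

theorem finsum_card_generatorOf :
    ∑ᶠ p : ℤ × ℤ, signedMonomial p * C (Fintype.card (D.GeneratorOf p.1 p.2) : ℤ) =
      ∑ a : D.Generator, signedMonomial (D.bidegree a) := by
  classical
  rw [finsum_eq_sum_of_support_subset (s := Finset.univ.image D.bidegree)]
  · rw [← Finset.sum_fiberwise_of_maps_to (s := Finset.univ) (t := Finset.univ.image D.bidegree)
      (g := D.bidegree) (fun a ha => Finset.mem_image_of_mem _ ha)]
    refine Finset.sum_congr rfl fun p _ => ?_
    rw [Finset.sum_congr rfl (g := fun _ => signedMonomial p)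
      (fun a ha => by rw [(Finset.mem_filter.1 ha).2]), Finset.sum_const, nsmul_eq_mul, mul_comm]
    congr 1
    rw [← Fintype.card_subtype]
    have : Fintype.card (D.GeneratorOf p.1 p.2) = Fintype.card {a // D.bidegree a = p} :=
      Fintype.card_congr (Equiv.subtypeEquivRight fun a => by
        unfold bidegree
        rw [Prod.ext_iff])
    rw [this]
    simp
  · intro p hp
    have h1 : Fintype.card (D.GeneratorOf p.1 p.2) ≠ 0 := by
      intro h0
      simp [h0] at hp
    obtain ⟨a⟩ := Fintype.card_pos_iff.1 (Nat.pos_of_ne_zero h1)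
    simp only [Finset.coe_image, Finset.coe_univ, Set.image_univ]
    exact ⟨a.1, Prod.ext a.2.1 a.2.2⟩

/-- Each differential lowers the dimension of homology by its rank in two adjacent degrees, with
opposite signs. The shift `e` of the homological degree matches these terms, and finite support
allows the reindexing. -/
theorem khEuler_eq_sum_generators : D.khEuler = ∑ a : D.Generator, signedMonomial (D.bidegree a) := by
  rw [← finsum_card_generatorOf]
  let R : ℤ × ℤ → ℤ[T;T⁻¹] := fun p => signedMonomial p * C (D.diffRank p.1 (p.1 + 1) p.2 : ℤ)
  let e : ℤ × ℤ ≃ ℤ × ℤ := (Equiv.subRight (1 : ℤ)).prodCongr (Equiv.refl ℤ)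
  have hR : R.HasFiniteSupport := D.hasFiniteSupport_of_le_card _ fun p => D.diffRank_le _ _ _
  have hRe : (fun p => R (e p)).HasFiniteSupport :=
    hR.preimage e.injective.injOn
  have hG := D.hasFiniteSupport_of_le_card _ fun p => le_rfl
  have h1 : ∀ p : ℤ × ℤ, C ((Int.negOnePow p.1 : ℤ) *
      (Module.finrank (ZMod 2) (D.Kh p.1 p.2) : ℤ)) * T p.2 =
      (signedMonomial p * C (Fintype.card (D.GeneratorOf p.1 p.2) : ℤ) + R (e p)) - R p := by
    intro p
    have h2 : R (e p) = - (signedMonomial p * C (D.diffRank (p.1 - 1) p.1 p.2 : ℤ)) := by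
      change signedMonomial (p.1 - 1, p.2) * C (D.diffRank (p.1 - 1) (p.1 - 1 + 1) p.2 : ℤ) = _
      rw [sub_add_cancel, signedMonomial_sub_one, neg_mul]
    rw [h2, D.finrank_Kh]
    simp only [R, signedMonomial, map_mul, map_sub]
    ring
  have hGR : (fun p : ℤ × ℤ => signedMonomial p * C (Fintype.card (D.GeneratorOf p.1 p.2) : ℤ) +
      R (e p)).HasFiniteSupport := hG.add hRe
  unfold khEuler
  simp only [h1]
  rw [finsum_sub_distrib hGR hR, finsum_add_distrib hG hRe, finsum_comp_equiv e (f := R),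
    add_sub_cancel_right]

/-- The ordinary link diagram `D_A`. -/
abbrev resolveAll (A : Finset V) : LinkDiagram V :=
  ⟨D.shadow, D.signOf A⟩

theorem C_negOnePow_natCast (n : ℕ) : (C (Int.negOnePow n : ℤ) : ℤ[T;T⁻¹]) = (-1) ^ n := by
  rw [Int.coe_negOnePow_natCast, map_pow, map_neg, map_one]

theorem signedMonomial_bidegree {A : Finset V} (hA : A ⊆ D.doublePoints) (s : Finset V)
    (ρ : D.shadow.Circles (D.smoothingOf A s) → Label) :
    signedMonomial (D.bidegree ⟨⟨A, hA⟩, ⟨s, ρ⟩⟩) = (-1) ^ (D.doublePoints.card - A.card) *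
      ((-1) ^ numSign (D.signOf A) .neg *
        T ((numSign (D.signOf A) .pos : ℤ) - 2 * (numSign (D.signOf A) .neg : ℤ)) *
        ((-T 1) ^ s.card * T (D.shadow.labelDegree ρ))) := by
  have h := Finset.card_le_card hA
  unfold signedMonomial bidegree homDegree quantumDegree Shadow.homDegree Shadow.quantumDegree
  dsimp only
  rw [← Nat.cast_sub h, Int.negOnePow_sub, Int.negOnePow_sub, Units.val_mul, Units.val_mul,
    map_mul, map_mul, C_negOnePow_natCast, C_negOnePow_natCast, C_negOnePow_natCast, neg_pow (T 1 : ℤ[T;T⁻¹]),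
    T_pow, mul_one]
  have : D.shadow.labelDegree ρ + (s.card : ℤ) + (numSign (D.signOf A) .pos : ℤ) -
      2 * (numSign (D.signOf A) .neg : ℤ) = ((numSign (D.signOf A) .pos : ℤ) -
      2 * (numSign (D.signOf A) .neg : ℤ)) + (s.card + D.shadow.labelDegree ρ) := by ring
  rw [this, T_add, T_add]
  ring

theorem sum_generators {M : Type*} [AddCommMonoid M] (F : D.Generator → M)
    [∀ A s, Fintype (D.shadow.Circles (D.smoothingOf A s) → Label)] :
    ∑ a, F a = ∑ A : {A : Finset V // A ⊆ D.doublePoints}, ∑ s : Finset V,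
      ∑ ρ : D.shadow.Circles (D.smoothingOf A.1 s) → Label, F ⟨A, ⟨s, ρ⟩⟩ := by
  have : D.fintypeGenerator = Sigma.instFintype := Subsingleton.elim _ _
  rw [this, Fintype.sum_sigma]
  exact Finset.sum_congr rfl fun A _ => Fintype.sum_sigma _

theorem khEuler_eq_sum_jones : D.khEuler = ∑ A ∈ D.doublePoints.powerset,
    (-1) ^ (D.doublePoints.card - A.card) * (D.resolveAll A).jones := by
  have := fun A s => Fintype.ofFinite (D.shadow.Circles (D.smoothingOf A s) → Label)
  rw [D.khEuler_eq_sum_generators, D.sum_generators,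
    Finset.sum_subtype (p := fun A => A ⊆ D.doublePoints) D.doublePoints.powerset
      fun A => Finset.mem_powerset]
  refine Finset.sum_congr rfl fun A _ => ?_
  unfold LinkDiagram.jones
  simp only [D.signedMonomial_bidegree, ← Finset.mul_sum, Shadow.sum_T_labelDegree]

end SingularLinkDiagram

/-! ## Vassiliev derivatives -/

namespace SingularLinkDiagram

variable {V : Type*} [Fintype V] [DecidableEq V] (D : SingularLinkDiagram V)

theorem doublePoints_resolve (b : V) (ε : CrossingSign) :
    (D.resolve b ε).doublePoints = D.doublePoints.erase b := by
  ext v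
  rw [Finset.mem_erase, mem_doublePoints, mem_doublePoints]
  by_cases hv : v = b
  · subst hv
    simp [resolve]
  · simp [resolve, hv]

theorem resolveAll_resolve_pos {b : V} (hb : D.kind b = .double) (A : Finset V) :
    (D.resolve b .pos).resolveAll A = D.resolveAll (insert b A) := by
  unfold resolveAll
  congr 1
  funext v
  by_cases hv : v = b
  · subst hv
    simp [signOf, resolve, hb]
  · simp [signOf, resolve, hv]

theorem resolveAll_resolve_neg {b : V} (hb : D.kind b = .double) {A : Finset V} (hA : b ∉ A) :
    (D.resolve b .neg).resolveAll A = D.resolveAll A := by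
  unfold resolveAll
  congr 1
  funext v
  by_cases hv : v = b
  · subst hv
    simp [signOf, resolve, hb, hA]
  · simp [signOf, resolve, hv]

/-- The alternating sum of the values on all resolutions. -/
def alternatingSum {R : Type*} [Ring R] (v : LinkDiagram V → R) : R :=
  ∑ A ∈ D.doublePoints.powerset, (-1) ^ (D.doublePoints.card - A.card) * v (D.resolveAll A)

/-- The sets `A` containing `b` give the resolutions of `D_+`, the others those of `D_-`; in the
latter the exponent exceeds that of the resolved diagram by one, whence the minus sign. -/
theorem alternatingSum_resolve {R : Type*} [Ring R] (v : LinkDiagram V → R) {b : V}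
    (hb : D.kind b = .double) : D.alternatingSum v =
      (D.resolve b .pos).alternatingSum v - (D.resolve b .neg).alternatingSum v := by
  have hb' : b ∈ D.doublePoints := D.mem_doublePoints.2 hb
  have hcard := Finset.card_erase_add_one hb'
  unfold alternatingSum
  simp only [doublePoints_resolve]
  conv_lhs => rw [← Finset.insert_erase hb']
  rw [Finset.sum_powerset_insert (Finset.notMem_erase b _), add_comm, sub_eq_add_neg,
    ← Finset.sum_neg_distrib, Finset.card_insert_of_notMem (Finset.notMem_erase b _)]
  congr 1
  · refine Finset.sum_congr rfl fun A hA => ?_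
    have hbA : b ∉ A := fun h => Finset.notMem_erase b _ (Finset.mem_powerset.1 hA h)
    rw [D.resolveAll_resolve_pos hb, Finset.card_insert_of_notMem hbA, Nat.add_sub_add_right]
  · refine Finset.sum_congr rfl fun A hA => ?_
    have hbA : b ∉ A := fun h => Finset.notMem_erase b _ (Finset.mem_powerset.1 hA h)
    have hle := Finset.card_le_card (Finset.mem_powerset.1 hA)
    rw [D.resolveAll_resolve_neg hb hbA, Nat.sub_add_comm hle, pow_succ]
    simp

omit [DecidableEq V] in
theorem doublePoints_toSingular (L : LinkDiagram V) : L.toSingular.doublePoints = ∅ := by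
  simp [doublePoints, LinkDiagram.toSingular]

theorem alternatingSum_toSingular {R : Type*} [Ring R] (v : LinkDiagram V → R)
    (L : LinkDiagram V) : L.toSingular.alternatingSum v = v L := by
  unfold alternatingSum
  simp [doublePoints_toSingular]
  rfl

theorem eq_toSingular (h : D.doublePoints = ∅) : D = (D.resolveAll ∅).toSingular := by
  obtain ⟨S, k⟩ := D
  unfold LinkDiagram.toSingular resolveAll
  congr 1
  funext v
  have hv : k v ≠ .double := fun h' => by
    have : v ∈ (⟨S, k⟩ : SingularLinkDiagram V).doublePoints := (mem_doublePoints _).2 h'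
    rw [h] at this
    simp at this
  unfold signOf
  dsimp only
  rcases h' : k v with ε | _
  · rfl
  · exact absurd h' hv

theorem _root_.HasVassilievDerivative.eq_alternatingSum {R : Type*} [Ring R]
    {v : LinkDiagram V → R} {r : ℕ} {D : SingularLinkDiagram V} {a : R}
    (h : HasVassilievDerivative v r D a) : a = D.alternatingSum v := by
  induction h with
  | zero L => rw [alternatingSum_toSingular]
  | succ r D b hb x y _ _ hx hy => rw [D.alternatingSum_resolve v hb, hx, hy]

theorem hasVassilievDerivative_alternatingSum {R : Type*} [Ring R] (v : LinkDiagram V → R) (r : ℕ) :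
    ∀ D : SingularLinkDiagram V, D.doublePoints.card = r →
      HasVassilievDerivative v r D (D.alternatingSum v) := by
  induction r with
  | zero =>
    intro D hD
    rw [D.eq_toSingular (Finset.card_eq_zero.1 hD), alternatingSum_toSingular]
    exact .zero _
  | succ r ih =>
    intro D hD
    obtain ⟨b, hb⟩ : D.doublePoints.Nonempty := Finset.card_pos.1 (by omega)
    have hb' := D.mem_doublePoints.1 hb
    have hcard : ∀ ε, (D.resolve b ε).doublePoints.card = r := fun ε => by
      rw [doublePoints_resolve, Finset.card_erase_of_mem hb, hD, Nat.add_sub_cancel]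
    rw [D.alternatingSum_resolve v hb']
    exact .succ r D b hb' _ _ (ih _ (hcard _)) (ih _ (hcard _))

end SingularLinkDiagram

/-- The equivalence carries both existence of the derivative and independence of the order of
resolution: every value obtained from any order equals the alternating sum. -/
theorem mainTheorem3 {V : Type*} [Fintype V] [DecidableEq V] (D : SingularLinkDiagram V) (r : ℕ)
    (hr : D.doublePoints.card = r) :
    (∀ i j : ℤ, D.diff i (i + 1) j ∘ₗ D.diff (i - 1) i j = 0) ∧
      ∀ a : ℤ[T;T⁻¹], HasVassilievDerivative LinkDiagram.jones r D a ↔ a = D.khEuler := by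
  refine ⟨D.diff_comp_diff, fun a => ?_⟩
  have h : D.khEuler = D.alternatingSum LinkDiagram.jones := D.khEuler_eq_sum_jones
  rw [h]
  constructor
  · exact HasVassilievDerivative.eq_alternatingSum
  · rintro rfl
    exact SingularLinkDiagram.hasVassilievDerivative_alternatingSum _ r D hr
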